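/- **Setting.** Let $N,d\ge 1$ be integers, $T>0$, $\mathcal X=\{1,\dots,d\}$, $\Sigma=\{\mu\in\{0,\tfrac1N,\dots,1\}^d:\sum_x\mu_x=1\}$ and $\mathscr X=\mathcal X\times\Sigma$. Write $e_{x,z}=\tfrac1N(e_x-e_z)$. A vector $a\in\mathbb R_+^{d-1}$, $\mathbb R_+=[0,\infty)$, attached to a state $x$ is indexed by the states $y\ne x$ (in increasing order). Given are rates $\lambda^0,\lambda^1:\mathscr X\to\mathbb R_+^{d-1}$, a terminal cost $g:\mathscr X\to\mathbb R_+$ and a running cost $\ell:\mathscr X\times\mathbb R_+^{d-1}\to\mathbb R_+$, continuous and strongly convex: for some $\gamma>0$ and all $(x,\mu)\in\mathscr X$, $a,a'\in\mathbb R_+^{d-1}$, $\tau\in[0,1]$, $$\tau\ell(x,\mu,a')+(1-\tau)\ell(x,\mu,a)-\ell(x,\mu,\tau a'+(1-\tau)a)\ge\gamma\tau(1-\tau)|a'-a|_2^2 .$$ Let $\mathscr A$ be the set of Lipschitz functions $[0,T]\times\mathscr X\to\mathbb R_+^{d-1}$. For $\alpha,\beta\in\mathscr A$ let $\Xi$ be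 the time-inhomogeneous Markov chain on $\mathscr X$ which at time $t$ jumps from $(x,\mu)$ to $(y,\mu)$, $y\neq x$, at rate $\lambda^0_y(x,\mu)+\lambda^1_y(x,\mu)\alpha_y(t,x,\mu)$ and, for each pair $y\ne z$ with $\mu_z>0$, from $(x,\mu)$ to $(x,\mu+e_{y,z})$ at rate $N\mu_z[\lambda^0_y(z,\mu+e_{x,z})+\lambda^1_y(z,\mu+e_{x,z})\beta_y(t,z,\mu+e_{x,z})]$. Set $$J(t,x,\mu,\alpha;\beta)=\mathbb E^{\alpha\otimes\beta}\Big[\int_t^T\ell(\Xi_u,\alpha(u,\Xi_u))\,du+g(\Xi_T)\,\Big|\,\Xi_t=(x,\mu)\Big],\qquad v^\beta(t,x,\mu)=\inf_{\alpha\in\mathscr A}J(t,x,\mu,\alpha;\beta),$$ $$\hat\alpha(x,\mu,p)=\operatorname*{arg\,min}_{a\in\mathbb R_+^{d-1}}\Big\{\ell(x,\mu,a)+\sum_{y\ne x}a_y\lambda^1_y(x,\mu)p_y\Big\},\qquad \alpha^*(\beta)(t,x,\mu)=\hat\alpha\big(x,\mu,(v^\beta(t,y,\mu)-v^\beta(t,x,\mu))_{y\ne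 x}\big).$$ For $\delta>0$, a control $\beta\in\mathscr A$ is a $\delta$-Markov perfect equilibrium if $J(t,x,\mu,\beta;\beta)\le J(t,x,\mu,\alpha;\beta)+\delta$ for all $(t,x,\mu)\in[0,T]\times\mathscr X$, $\alpha\in\mathscr A$. For functions $\psi$ on $[0,T]\times\mathscr X$ let $|\psi(t)|_2^2=\sum_{(x,\mu)\in\mathscr X}|\psi(t,x,\mu)|_2^2$ and $\|\psi\|_{\mathcal S}=\max_{t\in[0,T]}|\psi(t)|_2$. Given $\beta^{(0)}\in\mathscr A$ and errors $\varepsilon^{(n)}\in\mathscr A$, $n\ge1$, put $\hat\beta^{(0)}=\beta^{(0)}$ and, for $n\ge1$, $$v^{(n)}=v^{\beta^{(n-1)}},\quad \beta^{(n)}=\alpha^*(\beta^{(n-1)}),\qquad \hat v^{(n)}=v^{\hat\beta^{(n-1)}},\quad \hat\beta^{(n)}=\alpha^*(\hat\beta^{(n-1)})+\varepsilon^{(n)},$$ $$q^{(n)}(t)=|\hat v^{(n)}(t)-v^{(n)}(t)|_2^2,\qquad \gamma^{(n)}(t)=|\hat\beta^{(n)}(t)-\beta^{(n)}(t)|_2^2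 .$$ **Proposition.** (a) There are constants $c_0,c^*>0$ such that for all $\beta,\tilde\beta\in\mathscr A$ and $t\in[0,T]$ $$|\alpha^*(\beta)(t)-\alpha^*(\tilde\beta)(t)|_2\le c_0|v^\beta(t)-v^{\tilde\beta}(t)|_2,\qquad |v^\beta(t)-v^{\tilde\beta}(t)|_2^2\le c^*\int_t^T|\tilde\beta(s)-\beta(s)|_2^2\,ds .\qquad(1)$$ (b) For any constants $c_0,c^*>0$ with (1), put $\hat c_0=2(c_0^2\vee1)$ and $c_{*,0}=c^*\hat c_0$. Then for all $\beta^{(0)}$, $(\varepsilon^{(n)})_{n\geq 1}$ as above, $n\ge2$ and $t\in[0,T]$, $$\gamma^{(n-1)}(t)\le\hat c_0\sum_{k=1}^{n-1}\frac{c_{*,0}^{k-1}(T-t)^{k-1}}{(k-1)!}\|\varepsilon^{(n-k)}\|_{\mathcal S}^2,\qquad q^{(n)}(t)\le\sum_{k=1}^{n-1}\frac{c_{*,0}^k(T-t)^k}{k!}\|\varepsilon^{(n-k)}\|_{\mathcal S}^2 .$$ (c) There are constants $\kappa_*,\tilde c>0$, depending only on $N,d,T,\lambda^0,\lambda^1,\ell,g$,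 such that for all $\beta^{(0)}$, $(\varepsilon^{(n)})_{n\ge1}$ as above $$\sup_{n\ge1}\Big(\max_{[0,T]}\gamma^{(n)}+\max_{[0,T]}q^{(n)}\Big)\le\tilde c\,\sup_{n\ge1}\|\varepsilon^{(n)}\|_{\mathcal S}^2$$ and such that, for every $\varepsilon_*$ with $0<\varepsilon_*\le1/(\tilde c+1)$, there is $n_*=n_*(\varepsilon_*)\ge1$ with the following property: if $\sup_{n\ge1}\|\varepsilon^{(n)}\|_{\mathcal S}\le\varepsilon_*$, then $\hat\beta^{(n)}$ is a $\kappa_*(\tilde c+1)\varepsilon_*$-Markov perfect equilibrium for every $n\ge n_*$. -/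

import Mathlib

noncomputable section

namespace PicardGame

open Finset

/-- Control vectors in `ℝ^(d-1)`, with the Euclidean norm; the number of states is `d = m + 1`. -/
abbrev Ctrl (m : ℕ) := EuclideanSpace ℝ (Fin m)

/-- The discretized simplex. An element `μ` is stored through its counts `n_x = N μ_x`, which are
natural numbers that add up to `N`. -/
abbrev Simplex (m N : ℕ) := {n : Fin (m + 1) → ℕ // ∑ x, n x = N}

instance (m N : ℕ) : Finite (Simplex m N) :=
  Finite.of_injective
    (fun μ : Simplex m N => fun x : Fin (m + 1) =>
      (⟨μ.1 x, Nat.lt_succ_of_le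
        ((Finset.single_le_sum (fun i _ => Nat.zero_le (μ.1 i)) (Finset.mem_univ x)).trans
          μ.2.le)⟩ : Fin (N + 1)))
    (fun _ _ h => Subtype.ext (funext fun x => congrArg Fin.val (congrFun h x)))

instance (m N : ℕ) : Fintype (Simplex m N) := Fintype.ofFinite _

/-- The state space: position of the tagged player and distribution of the other players. -/
abbrev State (m N : ℕ) := Fin (m + 1) × Simplex m N

theorem sum_move {m : ℕ} (n : Fin (m + 1) → ℕ) (y z : Fin (m + 1)) (h : 0 < n z) :
    ∑ x, (n x + (if x = y then 1 else 0) - (if x = z then 1 else 0)) = ∑ x, n x := by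
  have key : ∑ x, (n x + (if x = y then 1 else 0) - (if x = z then 1 else 0))
      + ∑ x, (if x = z then 1 else 0) = ∑ x, n x + ∑ x, (if x = y then 1 else 0) := by
    rw [← Finset.sum_add_distrib, ← Finset.sum_add_distrib]
    refine Finset.sum_congr rfl fun x _ => ?_
    by_cases hx : x = z
    · subst hx; simp; omega
    · simp [hx]
  simp at key
  simpa using key

/-- `μ.move y z` is `μ + (e_y - e_z) / N`: one of the other players goes from `z` to `y`.
(If nobody is at `z` then it is `μ`; this case only occurs with a factor `n_z = 0`.) -/
def Simplex.move {m N : ℕ} (μ : Simplex m N) (y z : Fin (m + 1)) : Simplex m N :=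
  if h : 0 < μ.1 z then
    ⟨fun x => μ.1 x + (if x = y then 1 else 0) - (if x = z then 1 else 0),
      (sum_move μ.1 y z h).trans μ.2⟩
  else μ

/-- The data of the game with `N + 1` players and `m + 1` states, with the standing assumptions:
nonnegative rates and costs, and a continuous, strongly convex running cost.
The `i`-th component of a rate vector at the state `x` is the rate to `x.succAbove i`, which is the
`i`-th element of the list of all states other than `x`. -/
structure Game (m N : ℕ) where
  /-- time horizon -/
  T : ℝ
  T_pos : 0 < T
  /-- uncontrolled rates -/
  lam0 : State m N → Fin m → ℝ
  lam1 : State m N → Fin m → ℝ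
  lam0_nonneg : ∀ ξ i, 0 ≤ lam0 ξ i
  lam1_nonneg : ∀ ξ i, 0 ≤ lam1 ξ i
  /-- running cost; only its values at vectors with nonnegative components matter -/
  ell : State m N → Ctrl m → ℝ
  /-- terminal cost -/
  g : State m N → ℝ
  ell_nonneg : ∀ ξ (a : Ctrl m), (∀ i, 0 ≤ a i) → 0 ≤ ell ξ a
  g_nonneg : ∀ ξ, 0 ≤ g ξ
  ell_cont : ∀ ξ, ContinuousOn (ell ξ) {a | ∀ i, 0 ≤ a i}
  ell_convex : ∃ γ > 0, ∀ ξ (a a' : Ctrl m), (∀ i, 0 ≤ a i) → (∀ i, 0 ≤ a' i) →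
    ∀ τ ∈ Set.Icc (0 : ℝ) 1,
      γ * τ * (1 - τ) * ‖a' - a‖ ^ 2 ≤
        τ * ell ξ a' + (1 - τ) * ell ξ a - ell ξ (τ • a' + (1 - τ) • a)

/-- `|φ|_2` for a function `φ` on the state space. -/
def l2 {m N : ℕ} {F : Type*} [NormedAddCommGroup F] (φ : State m N → F) : ℝ :=
  √(∑ ξ, ‖φ ξ‖ ^ 2)

namespace Game

variable {m N : ℕ} (G : Game m N)

/-- `‖ψ‖_S = max_{t ∈ [0,T]} |ψ(t)|_2`. -/
def sNorm {F : Type*} [NormedAddCommGroup F] (ψ : ℝ → State m N → F) : ℝ :=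
  sSup ((fun t => l2 (ψ t)) '' Set.Icc 0 G.T)

/-- Admissible controls: functions on `[0,T] × State` with nonnegative components that are Lipschitz
continuous (only the values at times in `[0,T]` matter; the state space is finite). -/
def Admissible (α : ℝ → State m N → Ctrl m) : Prop :=
  (∀ t ∈ Set.Icc 0 G.T, ∀ ξ i, 0 ≤ α t ξ i) ∧
    ∃ K : NNReal, ∀ ξ, LipschitzOnWith K (fun t => α t ξ) (Set.Icc 0 G.T)

/-- Generator of the moves of the tagged player, who uses the rates `a`. -/
def genX (a : State m N → Ctrl m) (φ : State m N → ℝ) (ξ : State m N) : ℝ :=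
  ∑ i : Fin m, (G.lam0 ξ i + G.lam1 ξ i * a ξ i) * (φ (ξ.1.succAbove i, ξ.2) - φ ξ)

/-- Generator of the moves of the other players, who use the rates `b`: each of the `n_z` players at
`z` sees herself at `z` and the others, the tagged player included, distributed by
`μ + (e_x - e_z) / N`. -/
def genMu (b : State m N → Ctrl m) (φ : State m N → ℝ) (ξ : State m N) : ℝ :=
  ∑ z : Fin (m + 1), ∑ i : Fin m,
    (ξ.2.1 z : ℝ) * (G.lam0 (z, ξ.2.move ξ.1 z) i
        + G.lam1 (z, ξ.2.move ξ.1 z) i * b (z, ξ.2.move ξ.1 z) i)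
      * (φ (ξ.1, ξ.2.move (z.succAbove i) z) - φ ξ)

/-- `p u η` is the probability that the time-inhomogeneous Markov chain with generator
`genX (α u) + genMu (β u)`, started in `ξ` at time `t`, is in the state `η` at time `u ∈ [t,T]`.
This is the forward equation for the transition probabilities of the chain, written with
test functions `φ`. -/
structure IsLaw (α β : ℝ → State m N → Ctrl m) (t : ℝ) (ξ : State m N)
    (p : ℝ → State m N → ℝ) : Prop where
  init : ∀ η, p t η = if η = ξ then 1 else 0
  nonneg : ∀ u ∈ Set.Icc t G.T, ∀ η, 0 ≤ p u η
  sum_eq_one : ∀ u ∈ Set.Icc t G.T, ∑ η, p u η = 1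
  forward : ∀ φ : State m N → ℝ, ∀ u ∈ Set.Icc t G.T,
    HasDerivWithinAt (fun r => ∑ η, p r η * φ η)
      (∑ η, p u η * (G.genX (α u) φ η + G.genMu (β u) φ η)) (Set.Icc t G.T) u

/-- The law of the controlled state process at the times `u ∈ [t,T]`, given that it is in `ξ` at
time `t`. -/
def law (α β : ℝ → State m N → Ctrl m) (t : ℝ) (ξ : State m N) : ℝ → State m N → ℝ :=
  Classical.epsilon (G.IsLaw α β t ξ)

/-- The cost `J(t,ξ,α;β)` of the tagged player, i.e. the expectation of
`∫_t^T ℓ(Ξ_u, α(u,Ξ_u)) du + g(Ξ_T)` given `Ξ_t = ξ`. -/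
def J (t : ℝ) (ξ : State m N) (α β : ℝ → State m N → Ctrl m) : ℝ :=
  (∫ u in t..G.T, ∑ η, G.law α β t ξ u η * G.ell η (α u η))
    + ∑ η, G.law α β t ξ G.T η * G.g η

/-- The value function `v^β` of the tagged player when the other players use `β`. -/
def value (β : ℝ → State m N → Ctrl m) (t : ℝ) (ξ : State m N) : ℝ :=
  ⨅ α : {α : ℝ → State m N → Ctrl m // G.Admissible α}, G.J t ξ α.1 β

/-- The minimizer over `ℝ_+^(d-1)` of `a ↦ ℓ(ξ,a) + ∑ a_y λ¹_y(ξ) p_y`. -/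
def alphaHat (ξ : State m N) (p : Fin m → ℝ) : Ctrl m :=
  Classical.epsilon fun a : Ctrl m =>
    (∀ i, 0 ≤ a i) ∧ ∀ b : Ctrl m, (∀ i, 0 ≤ b i) →
      G.ell ξ a + ∑ i, a i * G.lam1 ξ i * p i ≤ G.ell ξ b + ∑ i, b i * G.lam1 ξ i * p i

/-- The best response `α^*(β)(t,x,μ) = α̂(x, μ, Δ_x v^β(t,·,μ))`. -/
def bestResponse (β : ℝ → State m N → Ctrl m) (t : ℝ) (ξ : State m N) : Ctrl m :=
  G.alphaHat ξ fun i => G.value β t (ξ.1.succAbove i, ξ.2) - G.value β t ξ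

/-- The controls `β^(n)` of the Picard iteration. -/
def picard (β₀ : ℝ → State m N → Ctrl m) : ℕ → ℝ → State m N → Ctrl m
  | 0 => β₀
  | n + 1 => G.bestResponse (picard β₀ n)

/-- The controls `β̂^(n)` of the Picard iteration with the error `ε^(n)` in the `n`-th step. -/
def picardErr (β₀ : ℝ → State m N → Ctrl m) (ε : ℕ → ℝ → State m N → Ctrl m) :
    ℕ → ℝ → State m N → Ctrl m
  | 0 => β₀
  | n + 1 => G.bestResponse (picardErr β₀ ε n) + ε (n + 1)

/-- The value functions `v^(n) = v^{β^(n-1)}`, `n ≥ 1`. -/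
def picardValue (β₀ : ℝ → State m N → Ctrl m) (n : ℕ) : ℝ → State m N → ℝ :=
  G.value (G.picard β₀ (n - 1))

/-- The value functions `v̂^(n) = v^{β̂^(n-1)}`, `n ≥ 1`. -/
def picardErrValue (β₀ : ℝ → State m N → Ctrl m) (ε : ℕ → ℝ → State m N → Ctrl m) (n : ℕ) :
    ℝ → State m N → ℝ :=
  G.value (G.picardErr β₀ ε (n - 1))

/-- `q^(n)(t) = |v̂^(n)(t) - v^(n)(t)|_2^2`. -/
def q (β₀ : ℝ → State m N → Ctrl m) (ε : ℕ → ℝ → State m N → Ctrl m) (n : ℕ) (t : ℝ) : ℝ :=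
  l2 (G.picardErrValue β₀ ε n t - G.picardValue β₀ n t) ^ 2

/-- `γ^(n)(t) = |β̂^(n)(t) - β^(n)(t)|_2^2`. -/
def gam (β₀ : ℝ → State m N → Ctrl m) (ε : ℕ → ℝ → State m N → Ctrl m) (n : ℕ) (t : ℝ) : ℝ :=
  l2 (G.picardErr β₀ ε n t - G.picard β₀ n t) ^ 2

/-- `c₀` is a Lipschitz constant of the best response in terms of the value function. -/
def IsResponseConst (c₀ : ℝ) : Prop :=
  0 < c₀ ∧ ∀ β β', G.Admissible β → G.Admissible β' → ∀ t ∈ Set.Icc 0 G.T,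
    l2 (G.bestResponse β t - G.bestResponse β' t) ≤ c₀ * l2 (G.value β t - G.value β' t)

/-- `c` is a constant in the stability estimate for the value function. -/
def IsStabilityConst (c : ℝ) : Prop :=
  0 < c ∧ ∀ β β', G.Admissible β → G.Admissible β' → ∀ t ∈ Set.Icc 0 G.T,
    l2 (G.value β t - G.value β' t) ^ 2 ≤ c * ∫ s in t..G.T, l2 (β' s - β s) ^ 2

/-- `ĉ₀ = 2 (c₀² ∨ 1)`. -/
def chat (c₀ : ℝ) : ℝ := 2 * max (c₀ ^ 2) 1

/-- The bound `Γ^(n)(t)`, with `c₀` and `c = c^*`, so that `c_{*,0} = c * chat c₀`. -/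
def GammaBound (c₀ c : ℝ) (ε : ℕ → ℝ → State m N → Ctrl m) (n : ℕ) (t : ℝ) : ℝ :=
  chat c₀ * ∑ k ∈ Finset.Icc 1 n,
    (c * chat c₀) ^ (k - 1) * (G.T - t) ^ (k - 1) / ((k - 1).factorial : ℝ)
      * G.sNorm (ε (n + 1 - k)) ^ 2

/-- The bound `Q^(n)(t)`. -/
def QBound (c₀ c : ℝ) (ε : ℕ → ℝ → State m N → Ctrl m) (n : ℕ) (t : ℝ) : ℝ :=
  ∑ k ∈ Finset.Icc 1 (n - 1),
    (c * chat c₀) ^ k * (G.T - t) ^ k / (k.factorial : ℝ) * G.sNorm (ε (n - k)) ^ 2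

/-- `γ` is a `δ`-Markov perfect equilibrium. -/
def IsApproxMPE (δ : ℝ) (γ : ℝ → State m N → Ctrl m) : Prop :=
  G.Admissible γ ∧ ∀ t ∈ Set.Icc 0 G.T, ∀ ξ, ∀ α, G.Admissible α →
    G.J t ξ γ γ ≤ G.J t ξ α γ + δ

end Game

end PicardGame

end

noncomputable section

namespace PicardGame

open Finset

/-! ### Ordinary differential equations -/

/-! For a fixed `β` the tagged player solves a finite-state control problem. Strong convexity makes
the minimizer of the Hamiltonian Lipschitz in the increments of the value
(`exists_alphaHat_lipschitz`), so the dynamic programming equation is an ODE with a locally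
Lipschitz right-hand side. It has a bounded solution `V` on `[0,T]` (`exists_isValueSol`), whose
optimal feedback is again admissible.

Everything about costs rests on one identity, `cost_sub_value`. If `V` solves the equation for `β'`,
Dynkin's formula writes `J(α;β) - V` as the expected integral of the suboptimality gap of `α` plus
the effect of replacing `β'` by `β` in the generator. For `β = β'` this is verification: `V` is the
value function. For `α` optimal against `β'` the gap vanishes, which gives stability of the value in
`β`. For `α = β = β'` only the gap of `β` against its own value remains, and bounding it gives
approximate equilibria.

The error bounds are a Volterra iteration: `γ^(n)` is at most `ĉ₀` times `q^(n)` plus the squared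
new error, and `q^(n+1)` is at most `c` times the integral of `γ^(n)`. The claimed bounds satisfy
both recursions with equality, and exponential series bound them uniformly in `n`.

Without errors the same iteration makes consecutive exact values differ by a factorially small
amount, uniformly in the initial control. Hence for large `n` the controls `β̂^(n)` and `β̂^(n+1)`
have nearly equal values, and `β̂^(n+1)`, a perturbed best response to `β̂^(n)`, is nearly a best
response to itself. -/

theorem exists_solution_of_bounded_lipschitz {E : Type*} [NormedAddCommGroup E] [NormedSpace ℝ E]
    [CompleteSpace E] {f : ℝ → E → E} {a b : ℝ} {K L : NNReal}
    (hK : ∀ t ∈ Set.Icc a b, LipschitzWith K (f t))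
    (hc : ∀ x, ContinuousOn (f · x) (Set.Icc a b))
    (hL : ∀ t ∈ Set.Icc a b, ∀ x, ‖f t x‖ ≤ L) {t₀ : ℝ} (ht₀ : t₀ ∈ Set.Icc a b) (x₀ : E) :
    ∃ y : ℝ → E, y t₀ = x₀ ∧
      ∀ t ∈ Set.Icc a b, HasDerivWithinAt y (f t (y t)) (Set.Icc a b) t := by
  have hab : a ≤ b := ht₀.1.trans ht₀.2
  -- The global bound `L` confines solutions to a ball of radius `L * (b - a)`, so no shrinking of
  -- the time interval is needed.
  have h : IsPicardLindelof f (⟨t₀, ht₀⟩ : Set.Icc a b) x₀ (L * (b - a).toNNReal) 0 L K :=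
    { lipschitzOnWith := fun t ht => (hK t ht).lipschitzOnWith
      continuousOn := fun x _ => hc x
      norm_le := fun t ht x _ => hL t ht x
      mul_max_le := by
        simp only [NNReal.coe_mul, NNReal.coe_zero, sub_zero]
        rw [Real.coe_toNNReal _ (sub_nonneg.2 hab)]
        refine mul_le_mul_of_nonneg_left ?_ L.2
        exact max_le (by linarith [ht₀.1]) (by linarith [ht₀.2]) }
  exact h.exists_eq_forall_mem_Icc_hasDerivWithinAt₀

/-- After the last time with `f ≥ 0` before a negative value, `f` would be monotone. The sign of
`f'` matters only where `f < 0`, which is what truncated vector fields provide. -/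
theorem nonneg_of_deriv_nonneg_of_neg {f f' : ℝ → ℝ} {a b : ℝ}
    (hf : ∀ t ∈ Set.Icc a b, HasDerivWithinAt f (f' t) (Set.Icc a b) t)
    (ha : 0 ≤ f a) (h : ∀ t ∈ Set.Icc a b, f t < 0 → 0 ≤ f' t) :
    ∀ t ∈ Set.Icc a b, 0 ≤ f t := by
  intro t ht
  by_contra! hneg
  have hcont : ContinuousOn f (Set.Icc a b) := fun u hu => (hf u hu).continuousWithinAt
  set S : Set ℝ := Set.Icc a t ∩ f ⁻¹' Set.Ici 0 with hS
  have hsub : Set.Icc a t ⊆ Set.Icc a b := Set.Icc_subset_Icc_right ht.2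
  have hSc : IsClosed S := (hcont.mono hsub).preimage_isClosed_of_isClosed isClosed_Icc isClosed_Ici
  have hSne : S.Nonempty := ⟨a, ⟨le_rfl, ht.1⟩, ha⟩
  have hSb : BddAbove S := ⟨t, fun x hx => hx.1.2⟩
  have hs := hSc.csSup_mem hSne hSb
  set s := sSup S
  have hlt : ∀ u ∈ Set.Ioc s t, f u < 0 := by
    intro u hu
    by_contra! hu0
    exact absurd (le_csSup hSb (show u ∈ S from ⟨⟨hs.1.1.trans hu.1.le, hu.2⟩, hu0⟩)) (not_le.2 hu.1)
  have hsub' : Set.Icc s t ⊆ Set.Icc a b := (Set.Icc_subset_Icc_left hs.1.1).trans hsub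
  have hmono : MonotoneOn f (Set.Icc s t) := by
    refine monotoneOn_of_hasDerivWithinAt_nonneg (f' := f') (convex_Icc s t) (hcont.mono hsub') ?_ ?_
    · intro u hu
      exact (hf u (hsub' (interior_subset hu))).mono (interior_subset.trans hsub')
    · intro u hu
      rw [interior_Icc] at hu
      exact h u (hsub' ⟨hu.1.le, hu.2.le⟩) (hlt u ⟨hu.1, hu.2.le⟩)
  have := hmono ⟨le_rfl, hs.1.2⟩ ⟨hs.1.2, le_rfl⟩ hs.1.2
  have h0 : 0 ≤ f s := hs.2
  linarith

/-- Time reversal of the previous lemma, for terminal value problems. -/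
theorem nonneg_of_deriv_nonpos_of_neg {f f' : ℝ → ℝ} {a b : ℝ}
    (hf : ∀ t ∈ Set.Icc a b, HasDerivWithinAt f (f' t) (Set.Icc a b) t)
    (hb : 0 ≤ f b) (h : ∀ t ∈ Set.Icc a b, f t < 0 → f' t ≤ 0) :
    ∀ t ∈ Set.Icc a b, 0 ≤ f t := by
  have hmem : ∀ t ∈ Set.Icc a b, a + b - t ∈ Set.Icc a b := fun t ht =>
    ⟨by linarith [ht.2], by linarith [ht.1]⟩
  have key := nonneg_of_deriv_nonneg_of_neg (f := fun t => f (a + b - t))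
    (f' := fun t => -f' (a + b - t)) (a := a) (b := b) ?_ (by simpa using hb) ?_
  · intro t ht
    simpa using key _ (hmem t ht)
  · intro t ht
    have h1 : HasDerivWithinAt (fun t : ℝ => a + b - t) (-1) (Set.Icc a b) t :=
      (hasDerivWithinAt_id t _).const_sub (a + b)
    have := (hf _ (hmem t ht)).scomp t h1 (fun u hu => hmem u hu)
    simpa [Function.comp_def] using this
  · intro t ht hneg
    have := h _ (hmem t ht) hneg
    linarith

/-! ### The norm `l2` -/

section L2

variable {m N : ℕ} {F : Type*} [NormedAddCommGroup F]

theorem l2_eq_norm (φ : State m N → F) :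
    l2 φ = ‖(WithLp.toLp 2 φ : PiLp 2 fun _ : State m N => F)‖ := by
  rw [PiLp.norm_eq_of_L2]; rfl

theorem l2_nonneg (φ : State m N → F) : 0 ≤ l2 φ := Real.sqrt_nonneg _

@[simp] theorem l2_zero : l2 (0 : State m N → F) = 0 := by simp [l2]

theorem l2_add_le (φ ψ : State m N → F) : l2 (φ + ψ) ≤ l2 φ + l2 ψ := by
  simp only [l2_eq_norm, WithLp.toLp_add]
  exact norm_add_le _ _

theorem l2_sub_comm (φ ψ : State m N → F) : l2 (φ - ψ) = l2 (ψ - φ) := by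
  simp only [l2_eq_norm, WithLp.toLp_sub]
  exact norm_sub_rev _ _

theorem l2_sq (φ : State m N → F) : l2 φ ^ 2 = ∑ ξ, ‖φ ξ‖ ^ 2 :=
  Real.sq_sqrt (sum_nonneg fun _ _ => sq_nonneg _)

theorem norm_le_l2 (φ : State m N → F) (ξ : State m N) : ‖φ ξ‖ ≤ l2 φ := by
  refine Real.le_sqrt_of_sq_le ?_
  exact single_le_sum (f := fun ξ => ‖φ ξ‖ ^ 2) (fun _ _ => sq_nonneg _) (mem_univ ξ)

theorem pi_norm_le_l2 (φ : State m N → F) : ‖φ‖ ≤ l2 φ :=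
  (pi_norm_le_iff_of_nonneg (l2_nonneg φ)).2 (norm_le_l2 φ)

theorem l2_le_of_forall {φ : State m N → F} {C : ℝ} (hC : 0 ≤ C) (h : ∀ ξ, ‖φ ξ‖ ≤ C) :
    l2 φ ≤ √(Fintype.card (State m N)) * C := by
  rw [l2, ← Real.sqrt_sq hC, ← Real.sqrt_mul (Nat.cast_nonneg _)]
  refine Real.sqrt_le_sqrt ?_
  calc ∑ ξ, ‖φ ξ‖ ^ 2 ≤ ∑ _ξ : State m N, C ^ 2 := by
        gcongr with ξ; exact h ξ
    _ = _ := by simp [Fintype.card_prod]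

theorem continuous_l2 : Continuous (l2 : (State m N → F) → ℝ) := by
  unfold l2; fun_prop

end L2

/-! ### The minimizer of the Hamiltonian -/

namespace Game

variable {m N : ℕ} (G : Game m N)

/-- The set of admissible control vectors. -/
def orthant (m : ℕ) : Set (Ctrl m) := {a | ∀ i, 0 ≤ a i}

theorem isClosed_orthant : IsClosed (orthant m) := by
  simp only [orthant, Set.ofPred_forall]
  exact isClosed_iInter fun i => isClosed_le continuous_const (by fun_prop)

/-- The linear part `∑ a_y λ¹_y p_y` of the Hamiltonian. -/
def lin (ξ : State m N) (a : Ctrl m) (p : Fin m → ℝ) : ℝ := ∑ i, a i * G.lam1 ξ i * p i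

/-- The sum of all controlled rates. -/
def lamSum : ℝ := ∑ ξ, ∑ i, G.lam1 ξ i

theorem lamSum_nonneg : 0 ≤ G.lamSum :=
  sum_nonneg fun ξ _ => sum_nonneg fun i _ => G.lam1_nonneg ξ i

theorem sum_lam1_le (ξ : State m N) : ∑ i, G.lam1 ξ i ≤ G.lamSum :=
  single_le_sum (f := fun ξ => ∑ i, G.lam1 ξ i)
    (fun ξ _ => sum_nonneg fun i _ => G.lam1_nonneg ξ i) (mem_univ ξ)

theorem abs_lin_le (ξ : State m N) (a : Ctrl m) (p : Fin m → ℝ) :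
    |G.lin ξ a p| ≤ G.lamSum * ‖a‖ * ‖p‖ := by
  calc |G.lin ξ a p| ≤ ∑ i, |a i * G.lam1 ξ i * p i| := abs_sum_le_sum_abs _ _
    _ ≤ ∑ i, ‖a‖ * G.lam1 ξ i * ‖p‖ := by
        gcongr with i
        rw [abs_mul, abs_mul, abs_of_nonneg (G.lam1_nonneg ξ i)]
        have h1 : |a i| ≤ ‖a‖ := PiLp.norm_apply_le a i
        have h2 : |p i| ≤ ‖p‖ := norm_le_pi_norm p i
        have := G.lam1_nonneg ξ i
        gcongr
    _ = (∑ i, G.lam1 ξ i) * ‖a‖ * ‖p‖ := by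
        rw [sum_mul, sum_mul]; exact sum_congr rfl fun i _ => by ring
    _ ≤ G.lamSum * ‖a‖ * ‖p‖ := by gcongr; exact G.sum_lam1_le ξ

theorem lin_add_left (ξ : State m N) (a b : Ctrl m) (p : Fin m → ℝ) :
    G.lin ξ (a + b) p = G.lin ξ a p + G.lin ξ b p := by
  simp only [lin, ← sum_add_distrib, PiLp.add_apply]
  exact sum_congr rfl fun i _ => by ring

theorem lin_sub_left (ξ : State m N) (a b : Ctrl m) (p : Fin m → ℝ) :
    G.lin ξ (a - b) p = G.lin ξ a p - G.lin ξ b p := by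
  simp only [lin, ← sum_sub_distrib, PiLp.sub_apply]
  exact sum_congr rfl fun i _ => by ring

theorem lin_smul_left (ξ : State m N) (c : ℝ) (a : Ctrl m) (p : Fin m → ℝ) :
    G.lin ξ (c • a) p = c * G.lin ξ a p := by
  simp only [lin, mul_sum, PiLp.smul_apply, smul_eq_mul]
  exact sum_congr rfl fun i _ => by ring

theorem lin_sub_right (ξ : State m N) (a : Ctrl m) (p q : Fin m → ℝ) :
    G.lin ξ a (p - q) = G.lin ξ a p - G.lin ξ a q := by
  simp only [lin, ← sum_sub_distrib, Pi.sub_apply]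
  exact sum_congr rfl fun i _ => by ring

theorem continuous_lin_left (ξ : State m N) (p : Fin m → ℝ) : Continuous fun a => G.lin ξ a p := by
  unfold lin; fun_prop

/-- Strong convexity at the midpoint of `0` and `b`, with `ℓ ≥ 0`, gives `ℓ(b) ≥ γ/2 |b|² - ℓ(0)`.
This beats the linear term, so the search reduces to a compact set. -/
theorem exists_minimizer (ξ : State m N) (p : Fin m → ℝ) :
    ∃ a : Ctrl m, (∀ i, 0 ≤ a i) ∧ ∀ b : Ctrl m, (∀ i, 0 ≤ b i) →
      G.ell ξ a + G.lin ξ a p ≤ G.ell ξ b + G.lin ξ b p := by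
  obtain ⟨γ, hγ, hconv⟩ := G.ell_convex
  have h0 : ∀ i, 0 ≤ (0 : Ctrl m) i := fun i => le_rfl
  have hl0 := G.ell_nonneg ξ 0 h0
  set W := G.lamSum * ‖p‖ with hW
  have hW0 : 0 ≤ W := mul_nonneg G.lamSum_nonneg (norm_nonneg _)
  -- Chosen so that `γ/2 * R` exceeds `2 ℓ(0) + W`; the summand `1` ensures `‖b‖ ≥ 1` outside the
  -- ball.
  set R := 1 + 2 / γ * (2 * G.ell ξ 0 + W) with hR
  have hR1 : 1 ≤ R := by
    have : 0 ≤ 2 / γ * (2 * G.ell ξ 0 + W) := by positivity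
    linarith
  have hlin0 : G.lin ξ 0 p = 0 := by simp [lin]
  have hcoer : ∀ b : Ctrl m, (∀ i, 0 ≤ b i) → R < ‖b‖ →
      G.ell ξ 0 + G.lin ξ 0 p ≤ G.ell ξ b + G.lin ξ b p := by
    intro b hb hRb
    have h1 := hconv ξ 0 b h0 hb (1 / 2) ⟨by norm_num, by norm_num⟩
    have h2 := G.ell_nonneg ξ ((1 / 2 : ℝ) • b + (1 - 1 / 2 : ℝ) • (0 : Ctrl m)) (by
      intro i; simpa using hb i)
    have h3 := (abs_le.1 (G.abs_lin_le ξ b p)).1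
    rw [sub_zero] at h1
    have h4 : γ / 2 * R = γ / 2 + (2 * G.ell ξ 0 + W) := by rw [hR]; field_simp
    have h5 : γ / 2 * R * ‖b‖ ≤ γ / 2 * ‖b‖ * ‖b‖ := by
      have : γ / 2 * R ≤ γ / 2 * ‖b‖ := by gcongr
      gcongr
    have h6 : 2 * G.ell ξ 0 ≤ 2 * G.ell ξ 0 * ‖b‖ := by
      have : 1 ≤ ‖b‖ := by linarith
      nlinarith
    rw [h4] at h5
    have h7 : G.lamSum * ‖b‖ * ‖p‖ = W * ‖b‖ := by rw [hW]; ring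
    have h8 : 0 ≤ γ / 2 * ‖b‖ := by positivity
    rw [h7] at h3
    rw [hlin0]
    nlinarith
  have hcomp : IsCompact (orthant m ∩ Metric.closedBall 0 R) :=
    (isCompact_closedBall _ _).inter_left isClosed_orthant
  have hcont : ContinuousOn (fun a => G.ell ξ a + G.lin ξ a p)
      (orthant m ∩ Metric.closedBall 0 R) :=
    ((G.ell_cont ξ).mono Set.inter_subset_left).add (G.continuous_lin_left ξ p).continuousOn
  have hmem0 : (0 : Ctrl m) ∈ orthant m ∩ Metric.closedBall 0 R :=
    ⟨h0, by simp only [Metric.mem_closedBall, dist_self]; linarith⟩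
  obtain ⟨a, ha, hmin⟩ := hcomp.exists_isMinOn ⟨0, hmem0⟩ hcont
  refine ⟨a, ha.1, fun b hb => ?_⟩
  by_cases hbR : ‖b‖ ≤ R
  · exact hmin ⟨hb, by simpa using hbR⟩
  · exact (hmin hmem0).trans (hcoer b hb (not_le.1 hbR))

theorem alphaHat_nonneg (ξ : State m N) (p : Fin m → ℝ) (i : Fin m) : 0 ≤ G.alphaHat ξ p i :=
  (Classical.epsilon_spec (G.exists_minimizer ξ p)).1 i

theorem alphaHat_le (ξ : State m N) (p : Fin m → ℝ) {b : Ctrl m} (hb : ∀ i, 0 ≤ b i) :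
    G.ell ξ (G.alphaHat ξ p) + G.lin ξ (G.alphaHat ξ p) p ≤ G.ell ξ b + G.lin ξ b p :=
  (Classical.epsilon_spec (G.exists_minimizer ξ p)).2 b hb

/-- The minimal value of the Hamiltonian. -/
def ham (ξ : State m N) (p : Fin m → ℝ) : ℝ :=
  G.ell ξ (G.alphaHat ξ p) + G.lin ξ (G.alphaHat ξ p) p

/-- The suboptimality of the control vector `a`. -/
def gap (ξ : State m N) (a : Ctrl m) (p : Fin m → ℝ) : ℝ :=
  G.ell ξ a + G.lin ξ a p - G.ham ξ p

theorem gap_nonneg (ξ : State m N) (p : Fin m → ℝ) {b : Ctrl m} (hb : ∀ i, 0 ≤ b i) :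
    0 ≤ G.gap ξ b p := sub_nonneg.2 (G.alphaHat_le ξ p hb)

theorem gap_alphaHat (ξ : State m N) (p : Fin m → ℝ) : G.gap ξ (G.alphaHat ξ p) p = 0 :=
  sub_self _

/-- The gap grows quadratically away from the minimizer. Testing each of `p`, `p'` with the
minimizer of the other and adding cancels `ℓ`, leaving `γ |a - a'|² ≤ -lin (a - a') (p - p')`. -/
theorem exists_alphaHat_lipschitz :
    ∃ L : NNReal, ∀ ξ, LipschitzWith L (G.alphaHat ξ) := by
  obtain ⟨γ, hγ, hconv⟩ := G.ell_convex
  have growth : ∀ ξ p (b : Ctrl m), (∀ i, 0 ≤ b i) →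
      γ / 2 * ‖b - G.alphaHat ξ p‖ ^ 2 ≤ G.gap ξ b p := by
    intro ξ p b hb
    set a := G.alphaHat ξ p with ha
    have ha0 := G.alphaHat_nonneg ξ p
    have h1 := hconv ξ a b ha0 hb (1 / 2) ⟨by norm_num, by norm_num⟩
    have h2 := G.alphaHat_le ξ p (b := (1 / 2 : ℝ) • b + (1 - 1 / 2 : ℝ) • a) (by
      intro i
      have := hb i
      have := ha0 i
      simp only [PiLp.add_apply, PiLp.smul_apply, smul_eq_mul]
      rw [← ha] at this
      linarith)
    rw [← ha, lin_add_left, lin_smul_left, lin_smul_left] at h2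
    rw [gap, ham, ← ha]
    nlinarith
  refine ⟨(G.lamSum / γ).toNNReal, fun ξ => LipschitzWith.of_dist_le_mul fun p p' => ?_⟩
  rw [Real.coe_toNNReal _ (div_nonneg G.lamSum_nonneg hγ.le), dist_eq_norm, dist_eq_norm]
  have h1 := growth ξ p _ (G.alphaHat_nonneg ξ p')
  have h2 := growth ξ p' _ (G.alphaHat_nonneg ξ p)
  set a := G.alphaHat ξ p with ha
  set a' := G.alphaHat ξ p' with ha'
  have h3 := (abs_le.1 (G.abs_lin_le ξ (a - a') (p - p'))).1
  rw [lin_sub_right, lin_sub_left, lin_sub_left] at h3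
  rw [norm_sub_rev] at h1
  simp only [gap, ham, ← ha, ← ha'] at h1 h2
  have h4 : γ * ‖a - a'‖ ^ 2 ≤ G.lamSum * ‖a - a'‖ * ‖p - p'‖ := by linarith
  rcases (norm_nonneg (a - a')).eq_or_lt with h5 | h5
  · rw [← h5]
    have := G.lamSum_nonneg
    positivity
  · rw [div_mul_eq_mul_div, le_div_iff₀ hγ]
    refine le_of_mul_le_mul_right ?_ h5
    linarith

theorem exists_alphaHat_bound (C : ℝ) :
    ∃ R, 0 ≤ R ∧ ∀ ξ p, ‖p‖ ≤ C → ‖G.alphaHat ξ p‖ ≤ R := by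
  obtain ⟨L, hL⟩ := G.exists_alphaHat_lipschitz
  obtain ⟨B, hB⟩ := Finite.exists_le fun ξ : State m N => ‖G.alphaHat ξ 0‖
  refine ⟨max (B + L * C) 0, le_max_right _ _, fun ξ p hp => le_max_of_le_left ?_⟩
  have h1 := (hL ξ).dist_le_mul p 0
  rw [dist_eq_norm, dist_zero_right] at h1
  have h2 : ‖G.alphaHat ξ p‖ ≤ ‖G.alphaHat ξ p - G.alphaHat ξ 0‖ + ‖G.alphaHat ξ 0‖ := by
    simpa using norm_add_le (G.alphaHat ξ p - G.alphaHat ξ 0) (G.alphaHat ξ 0)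
  have h3 : (L : ℝ) * ‖p‖ ≤ L * C := by gcongr
  linarith [hB ξ]

/-- The Hamiltonian is a minimum of functions affine in `p`. Testing with the minimizer at the other
point bounds the slope by the size of that minimizer, hence only locally in `p`. -/
theorem exists_ham_lipschitz (C : ℝ) :
    ∃ K, 0 ≤ K ∧ ∀ ξ p p', ‖p‖ ≤ C → ‖p'‖ ≤ C → |G.ham ξ p - G.ham ξ p'| ≤ K * ‖p - p'‖ := by
  obtain ⟨R, hR0, hR⟩ := G.exists_alphaHat_bound C
  have hΛ := G.lamSum_nonneg
  have key : ∀ ξ p p', ‖p'‖ ≤ C → G.ham ξ p - G.ham ξ p' ≤ G.lamSum * R * ‖p - p'‖ := by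
    intro ξ p p' hp'
    have h1 := G.alphaHat_le ξ p (G.alphaHat_nonneg ξ p')
    have h2 := (abs_le.1 (G.abs_lin_le ξ (G.alphaHat ξ p') (p - p'))).2
    rw [lin_sub_right] at h2
    have h3 : G.lamSum * ‖G.alphaHat ξ p'‖ * ‖p - p'‖ ≤ G.lamSum * R * ‖p - p'‖ := by
      gcongr; exact hR ξ p' hp'
    simp only [ham]
    linarith
  refine ⟨G.lamSum * R, by positivity, fun ξ p p' hp hp' => abs_le.2 ⟨?_, key ξ p p' hp'⟩⟩
  have := key ξ p' p hp
  rw [norm_sub_rev] at this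
  linarith

theorem continuous_ham (ξ : State m N) : Continuous (G.ham ξ) := by
  obtain ⟨L, hL⟩ := G.exists_alphaHat_lipschitz
  have h1 : Continuous fun p => G.ell ξ (G.alphaHat ξ p) :=
    (G.ell_cont ξ).comp_continuous (hL ξ).continuous fun p => G.alphaHat_nonneg ξ p
  have h2 := (hL ξ).continuous
  unfold ham lin
  fun_prop

theorem exists_ell_bound (R : ℝ) :
    ∃ M, 0 ≤ M ∧ ∀ ξ (a : Ctrl m), (∀ i, 0 ≤ a i) → ‖a‖ ≤ R → G.ell ξ a ≤ M := by
  have hcomp : IsCompact (orthant m ∩ Metric.closedBall 0 R) :=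
    (isCompact_closedBall _ _).inter_left isClosed_orthant
  have h := fun ξ => hcomp.exists_bound_of_continuousOn
    ((G.ell_cont ξ).mono Set.inter_subset_left)
  choose M hM using h
  obtain ⟨B, hB⟩ := Finite.exists_le M
  refine ⟨max B 0, le_max_right _ _, fun ξ a ha haR => le_max_of_le_left ?_⟩
  exact (le_abs_self _).trans ((hM ξ a ⟨ha, by simpa using haR⟩).trans (hB ξ))

/-- The running cost need not be Lipschitz at the boundary of the orthant, but convexity gives a
one-sided estimate for nonnegative perturbations. -/
theorem exists_gap_perturb_le (C : ℝ) :
    ∃ K, 0 ≤ K ∧ ∀ ξ p p' (e : Ctrl m), ‖p‖ ≤ C → ‖p'‖ ≤ C → (∀ i, 0 ≤ e i) → ‖e‖ ≤ 1 →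
      G.gap ξ (G.alphaHat ξ p + e) p' ≤ K * (‖e‖ + ‖p - p'‖) := by
  obtain ⟨R, hR0, hR⟩ := G.exists_alphaHat_bound C
  obtain ⟨M, hM0, hM⟩ := G.exists_ell_bound (R + 1)
  obtain ⟨γ, hγ, hconv⟩ := G.ell_convex
  have hΛ := G.lamSum_nonneg
  refine ⟨M + G.lamSum * |C| + G.lamSum * (2 * R), by positivity, ?_⟩
  intro ξ p p' e hp hp' he he1
  set a := G.alphaHat ξ p with ha
  set a' := G.alphaHat ξ p' with ha'
  have ha0 : ∀ i, 0 ≤ a i := G.alphaHat_nonneg ξ p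
  -- The point `a + e` lies at the fraction `‖e‖` of the segment from `a` to `a + e/‖e‖`, whose far
  -- end stays in the orthant because `e ≥ 0`.
  have hell : G.ell ξ (a + e) ≤ G.ell ξ a + ‖e‖ * M := by
    rcases (norm_nonneg e).eq_or_lt with h0 | h0
    · rw [norm_eq_zero.1 h0.symm]; simp
    · have hnn : ∀ i, 0 ≤ (a + ‖e‖⁻¹ • e) i := fun i => by
        simp only [PiLp.add_apply, PiLp.smul_apply, smul_eq_mul]
        have := ha0 i
        have := he i
        positivity
      have h1 := hconv ξ a (a + ‖e‖⁻¹ • e) ha0 hnn ‖e‖ ⟨h0.le, he1⟩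
      have h2 : ‖e‖ • (a + ‖e‖⁻¹ • e) + (1 - ‖e‖) • a = a + e := by
        rw [smul_add, smul_smul, mul_inv_cancel₀ h0.ne', sub_smul, one_smul, one_smul]
        abel
      rw [h2] at h1
      have h3 : G.ell ξ (a + ‖e‖⁻¹ • e) ≤ M := by
        refine hM ξ _ hnn ((norm_add_le _ _).trans ?_)
        rw [norm_smul, norm_inv, norm_norm, inv_mul_cancel₀ h0.ne']
        linarith [hR ξ p hp]
      have h4 : 0 ≤ γ * ‖e‖ * (1 - ‖e‖) * ‖a + ‖e‖⁻¹ • e - a‖ ^ 2 := by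
        have : 0 ≤ 1 - ‖e‖ := by linarith
        positivity
      have h5 := G.ell_nonneg ξ a ha0
      nlinarith
  have h1 := G.alphaHat_le ξ p (G.alphaHat_nonneg ξ p')
  rw [← ha, ← ha'] at h1
  have h2 := (abs_le.1 (G.abs_lin_le ξ (a - a') (p - p'))).1
  rw [lin_sub_right, lin_sub_left, lin_sub_left] at h2
  have h3 := (abs_le.1 (G.abs_lin_le ξ e p')).2
  have h4 : G.lamSum * ‖e‖ * ‖p'‖ ≤ G.lamSum * ‖e‖ * |C| := by
    gcongr; exact hp'.trans (le_abs_self C)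
  have h5 : G.lamSum * ‖a - a'‖ * ‖p - p'‖ ≤ G.lamSum * (2 * R) * ‖p - p'‖ := by
    gcongr
    refine (norm_sub_le _ _).trans ?_
    linarith [hR ξ p hp, hR ξ p' hp']
  rw [gap, ham, lin_add_left, ← ha']
  have h6 : 0 ≤ (M + G.lamSum * |C|) * ‖p - p'‖ := by positivity
  have h7 : 0 ≤ G.lamSum * (2 * R) * ‖e‖ := by positivity
  nlinarith

/-! ### The generator -/

/-- The increments of a function along the moves of the tagged player. -/
def incr (φ : State m N → ℝ) (ξ : State m N) (i : Fin m) : ℝ :=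
  φ (ξ.1.succAbove i, ξ.2) - φ ξ

theorem norm_incr_le (φ : State m N → ℝ) (ξ : State m N) : ‖incr φ ξ‖ ≤ 2 * ‖φ‖ := by
  refine (pi_norm_le_iff_of_nonneg (by positivity)).2 fun i => ?_
  refine (norm_sub_le _ _).trans ?_
  linarith [norm_le_pi_norm φ (ξ.1.succAbove i, ξ.2), norm_le_pi_norm φ ξ]

theorem incr_sub (φ ψ : State m N → ℝ) (ξ : State m N) :
    incr (φ - ψ) ξ = incr φ ξ - incr ψ ξ := by
  ext i; simp only [incr, Pi.sub_apply]; ring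

theorem norm_incr_sub_le (φ ψ : State m N → ℝ) (ξ : State m N) :
    ‖incr φ ξ - incr ψ ξ‖ ≤ 2 * ‖φ - ψ‖ := by
  rw [← incr_sub]; exact norm_incr_le _ _

/-- The generator of the state process. -/
def gen (a b : State m N → Ctrl m) (φ : State m N → ℝ) (ξ : State m N) : ℝ :=
  G.genX a φ ξ + G.genMu b φ ξ

/-- Only the controlled part enters the Hamiltonian; the rest of the drift is the generator with
zero control, hence `gen 0` in the dynamic programming equation. -/
theorem genX_eq (a : State m N → Ctrl m) (φ : State m N → ℝ) (ξ : State m N) :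
    G.genX a φ ξ = G.genX 0 φ ξ + G.lin ξ (a ξ) (incr φ ξ) := by
  simp only [genX, lin, incr, ← sum_add_distrib, Pi.zero_apply, PiLp.zero_apply]
  exact sum_congr rfl fun i _ => by ring

theorem gen_add (a b : State m N → Ctrl m) (φ ψ : State m N → ℝ) (ξ : State m N) :
    G.gen a b (φ + ψ) ξ = G.gen a b φ ξ + G.gen a b ψ ξ := by
  have h1 : G.genX a (φ + ψ) ξ = G.genX a φ ξ + G.genX a ψ ξ := by
    simp only [genX, Pi.add_apply, ← sum_add_distrib]
    exact sum_congr rfl fun i _ => by ring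
  have h2 : G.genMu b (φ + ψ) ξ = G.genMu b φ ξ + G.genMu b ψ ξ := by
    simp only [genMu, Pi.add_apply, ← sum_add_distrib]
    exact sum_congr rfl fun z _ => sum_congr rfl fun i _ => by ring
  rw [gen, h1, h2, gen, gen]; ring

theorem gen_smul (a b : State m N → Ctrl m) (c : ℝ) (φ : State m N → ℝ) (ξ : State m N) :
    G.gen a b (c • φ) ξ = c * G.gen a b φ ξ := by
  simp only [gen, genX, genMu, Pi.smul_apply, smul_eq_mul, mul_add, mul_sum]
  congr 1
  · exact sum_congr rfl fun i _ => by ring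
  · exact sum_congr rfl fun z _ => sum_congr rfl fun i _ => by ring

theorem gen_const (a b : State m N → Ctrl m) (c : ℝ) (ξ : State m N) :
    G.gen a b (fun _ => c) ξ = 0 := by
  simp [gen, genX, genMu]

/-- The generator as a linear functional. -/
def genLin (a b : State m N → Ctrl m) (ξ : State m N) : (State m N → ℝ) →ₗ[ℝ] ℝ where
  toFun φ := G.gen a b φ ξ
  map_add' φ ψ := G.gen_add a b φ ψ ξ
  map_smul' c φ := G.gen_smul a b c φ ξ

/-- The entries of the rate matrix. -/
def rate (a b : State m N → Ctrl m) (ξ η : State m N) : ℝ := G.gen a b (Pi.single η 1) ξ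

theorem gen_eq_sum (a b : State m N → Ctrl m) (φ : State m N → ℝ) (ξ : State m N) :
    G.gen a b φ ξ = ∑ η, φ η * G.rate a b ξ η := by
  have h : φ = ∑ η, φ η • (Pi.single η (1 : ℝ) : State m N → ℝ) := by
    ext ζ; simp [Finset.sum_apply, Pi.single_apply]
  change G.genLin a b ξ φ = ∑ η, φ η * G.genLin a b ξ (Pi.single η 1)
  conv_lhs => rw [h]
  rw [map_sum]
  simp only [map_smul, smul_eq_mul]

theorem sum_rate (a b : State m N → Ctrl m) (ξ : State m N) : ∑ η, G.rate a b ξ η = 0 := by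
  have := G.gen_eq_sum a b (fun _ => 1) ξ
  simpa [G.gen_const] using this.symm

theorem gen_nonneg_of_min {a b : State m N → Ctrl m} (ha : ∀ ξ i, 0 ≤ a ξ i)
    (hb : ∀ ξ i, 0 ≤ b ξ i) {φ : State m N → ℝ} {ξ : State m N} (h : ∀ η, φ ξ ≤ φ η) :
    0 ≤ G.gen a b φ ξ := by
  have hr : ∀ (c : State m N → Ctrl m), (∀ ξ i, 0 ≤ c ξ i) → ∀ ζ i,
      0 ≤ G.lam0 ζ i + G.lam1 ζ i * c ζ i := fun c hc ζ i =>
    add_nonneg (G.lam0_nonneg ζ i) (mul_nonneg (G.lam1_nonneg ζ i) (hc ζ i))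
  refine add_nonneg (sum_nonneg fun i _ => ?_) (sum_nonneg fun z _ => sum_nonneg fun i _ => ?_)
  · exact mul_nonneg (hr a ha _ _) (sub_nonneg.2 (h _))
  · exact mul_nonneg (mul_nonneg (Nat.cast_nonneg _) (hr b hb _ _)) (sub_nonneg.2 (h _))

theorem gen_nonpos_of_max {a b : State m N → Ctrl m} (ha : ∀ ξ i, 0 ≤ a ξ i)
    (hb : ∀ ξ i, 0 ≤ b ξ i) {φ : State m N → ℝ} {ξ : State m N} (h : ∀ η, φ η ≤ φ ξ) :
    G.gen a b φ ξ ≤ 0 := by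
  have h1 := G.gen_nonneg_of_min ha hb (φ := (-1 : ℝ) • φ) (ξ := ξ) fun η => by
    simp only [Pi.smul_apply, smul_eq_mul]; linarith [h η]
  rw [gen_smul] at h1
  linarith

theorem rate_nonneg {a b : State m N → Ctrl m} (ha : ∀ ξ i, 0 ≤ a ξ i)
    (hb : ∀ ξ i, 0 ≤ b ξ i) {ξ η : State m N} (h : ξ ≠ η) : 0 ≤ G.rate a b ξ η := by
  refine G.gen_nonneg_of_min ha hb fun ζ => ?_
  rw [Pi.single_eq_of_ne h]
  exact (Pi.single_nonneg.2 zero_le_one : (0 : State m N → ℝ) ≤ Pi.single η 1) ζ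

theorem continuousOn_gen {α β : ℝ → State m N → Ctrl m} {φ : ℝ → State m N → ℝ} {s : Set ℝ}
    (hα : ∀ ξ, ContinuousOn (fun t => α t ξ) s) (hβ : ∀ ξ, ContinuousOn (fun t => β t ξ) s)
    (hφ : ∀ ξ, ContinuousOn (fun t => φ t ξ) s) (ξ : State m N) :
    ContinuousOn (fun t => G.gen (α t) (β t) (φ t) ξ) s := by
  unfold gen genX genMu
  fun_prop

theorem Admissible.continuousOn {G : Game m N} {α : ℝ → State m N → Ctrl m} (h : G.Admissible α)
    (ξ : State m N) : ContinuousOn (fun t => α t ξ) (Set.Icc 0 G.T) := by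
  obtain ⟨K, hK⟩ := h.2
  exact (hK ξ).continuousOn

theorem admissible_zero : G.Admissible 0 :=
  ⟨fun _ _ _ _ => le_rfl, 0, fun _ => (LipschitzWith.const (0 : Ctrl m)).lipschitzOnWith⟩

theorem Admissible.add {G : Game m N} {α β : ℝ → State m N → Ctrl m} (hα : G.Admissible α)
    (hβ : G.Admissible β) : G.Admissible (α + β) := by
  obtain ⟨K, hK⟩ := hα.2
  obtain ⟨K', hK'⟩ := hβ.2
  exact ⟨fun t ht ξ i => add_nonneg (hα.1 t ht ξ i) (hβ.1 t ht ξ i), K + K',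
    fun ξ => (hK ξ).add (hK' ξ)⟩

theorem exists_rate_bound {α β : ℝ → State m N → Ctrl m} (hα : G.Admissible α)
    (hβ : G.Admissible β) :
    ∃ B : NNReal, ∀ t ∈ Set.Icc 0 G.T, ∀ ξ η, |G.rate (α t) (β t) ξ η| ≤ B := by
  have hc : ContinuousOn (fun t => fun ξ η => G.rate (α t) (β t) ξ η) (Set.Icc 0 G.T) := by
    refine continuousOn_pi.2 fun ξ => continuousOn_pi.2 fun η => ?_
    exact G.continuousOn_gen (φ := fun _ => Pi.single η 1) hα.continuousOn hβ.continuousOn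
      (fun _ => continuousOn_const) ξ
  obtain ⟨B, hB⟩ := isCompact_Icc.exists_bound_of_continuousOn hc
  refine ⟨B.toNNReal, fun t ht ξ η => ?_⟩
  refine le_trans ?_ (Real.le_coe_toNNReal B)
  refine le_trans ?_ (hB t ht)
  exact (norm_le_pi_norm (fun η => G.rate (α t) (β t) ξ η) η).trans
    (norm_le_pi_norm (fun ξ η => G.rate (α t) (β t) ξ η) ξ)

/-- Truncation to the interval `[0, r]`. -/
def clip (r x : ℝ) : ℝ := max 0 (min x r)

theorem clip_nonneg (r x : ℝ) : 0 ≤ clip r x := le_max_left _ _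

theorem clip_le {r : ℝ} (hr : 0 ≤ r) (x : ℝ) : clip r x ≤ r := max_le hr (min_le_right _ _)

theorem clip_of_mem {r x : ℝ} (h0 : 0 ≤ x) (h1 : x ≤ r) : clip r x = x := by
  rw [clip, min_eq_left h1, max_eq_right h0]

theorem clip_of_nonpos {r x : ℝ} (h : x ≤ 0) : clip r x = 0 :=
  max_eq_left ((min_le_left _ _).trans h)

theorem clip_of_le {r x : ℝ} (hr : 0 ≤ r) (h : r ≤ x) : clip r x = r := by
  rw [clip, min_eq_right h, max_eq_right hr]

theorem abs_clip_sub_le (r x y : ℝ) : |clip r x - clip r y| ≤ |x - y| := by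
  have h : LipschitzWith 1 (clip r) := (LipschitzWith.id.min_const r).const_max 0
  simpa [Real.dist_eq] using h.dist_le_mul x y

theorem abs_clip_le {r : ℝ} (hr : 0 ≤ r) (x : ℝ) : |clip r x| ≤ r := by
  rw [abs_of_nonneg (clip_nonneg r x)]; exact clip_le hr x

/-! ### The law of the state process -/

/-- The forward equation is solved with entries truncated to `[0,1]`, a bounded and globally
Lipschitz field. Where an entry is negative its diagonal term is cut to zero and the inflow is
nonnegative; rows of the rate matrix sum to zero, so mass is conserved. The solution thus stays in
`[0,1]` and the truncation is inactive. -/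
theorem exists_isLaw {α β : ℝ → State m N → Ctrl m} (hα : G.Admissible α) (hβ : G.Admissible β)
    {t : ℝ} (ht : t ∈ Set.Icc 0 G.T) (ξ : State m N) : ∃ p, G.IsLaw α β t ξ p := by
  obtain ⟨B, hB⟩ := G.exists_rate_bound hα hβ
  have hsub : Set.Icc t G.T ⊆ Set.Icc 0 G.T := Set.Icc_subset_Icc_left ht.1
  set f : ℝ → (State m N → ℝ) → State m N → ℝ :=
    fun u p η => ∑ ζ, clip 1 (p ζ) * G.rate (α u) (β u) ζ η with hf
  set c : NNReal := Fintype.card (State m N) * B with hc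
  have hbd : ∀ u ∈ Set.Icc t G.T, ∀ (x : State m N → ℝ) (r : ℝ), 0 ≤ r → (∀ ζ, |x ζ| ≤ r) → ∀ η,
      |∑ ζ, x ζ * G.rate (α u) (β u) ζ η| ≤ c * r := by
    intro u hu x r hr hx η
    calc |∑ ζ, x ζ * G.rate (α u) (β u) ζ η|
        ≤ ∑ ζ, |x ζ * G.rate (α u) (β u) ζ η| := abs_sum_le_sum_abs _ _
      _ ≤ ∑ _ζ : State m N, r * B := by
          gcongr with ζ
          rw [abs_mul]
          exact mul_le_mul (hx ζ) (hB u (hsub hu) ζ η) (abs_nonneg _) hr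
      _ = c * r := by
          rw [sum_const, card_univ, nsmul_eq_mul, hc]; push_cast; ring
  have hex : ∃ p : ℝ → State m N → ℝ, p t = Pi.single ξ 1 ∧ ∀ u ∈ Set.Icc t G.T,
      HasDerivWithinAt p (f u (p u)) (Set.Icc t G.T) u := by
    refine exists_solution_of_bounded_lipschitz (K := c) (L := c) ?_ ?_ ?_ ⟨le_rfl, ht.2⟩ _
    · intro u hu
      refine LipschitzWith.of_dist_le_mul fun p q => ?_
      refine (dist_pi_le_iff (by positivity)).2 fun η => ?_
      rw [Real.dist_eq]
      simp only [hf, ← sum_sub_distrib, ← sub_mul]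
      refine hbd u hu (fun ζ => clip 1 (p ζ) - clip 1 (q ζ)) _ dist_nonneg (fun ζ => ?_) η
      exact (abs_clip_sub_le _ _ _).trans (dist_le_pi_dist p q ζ)
    · intro x
      refine continuousOn_pi.2 fun η => ?_
      refine continuousOn_finsetSum _ fun ζ _ => continuousOn_const.mul ?_
      exact (G.continuousOn_gen (φ := fun _ => Pi.single η 1) hα.continuousOn hβ.continuousOn
        (fun _ => continuousOn_const) ζ).mono hsub
    · intro u hu x
      refine (pi_norm_le_iff_of_nonneg c.2).2 fun η => ?_
      have := hbd u hu (fun ζ => clip 1 (x ζ)) 1 zero_le_one (fun ζ => abs_clip_le zero_le_one _) η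
      simpa using this
  obtain ⟨p, hp0, hp⟩ := hex
  have hder : ∀ η, ∀ u ∈ Set.Icc t G.T,
      HasDerivWithinAt (fun r => p r η) (f u (p u) η) (Set.Icc t G.T) u := fun η u hu =>
    hasDerivWithinAt_pi.1 (hp u hu) η
  have hnn : ∀ η, ∀ u ∈ Set.Icc t G.T, 0 ≤ p u η := by
    intro η
    refine nonneg_of_deriv_nonneg_of_neg (hder η) ?_ ?_
    · rw [hp0]
      exact (Pi.single_nonneg.2 zero_le_one : (0 : State m N → ℝ) ≤ Pi.single ξ 1) η
    · intro u hu hneg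
      refine sum_nonneg fun ζ _ => ?_
      by_cases hζ : ζ = η
      · rw [hζ, clip_of_nonpos hneg.le, zero_mul]
      · exact mul_nonneg (clip_nonneg _ _)
          (G.rate_nonneg (hα.1 u (hsub hu)) (hβ.1 u (hsub hu)) hζ)
  have hsum : ∀ u ∈ Set.Icc t G.T, ∑ η, p u η = 1 := by
    intro u hu
    have h0 : ∀ u ∈ Set.Icc t G.T,
        HasDerivWithinAt (fun r => ∑ η, p r η) 0 (Set.Icc t G.T) u := by
      intro u hu
      have h := HasDerivWithinAt.fun_sum (u := univ) fun η _ => hder η u hu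
      refine h.congr_deriv ?_
      simp only [hf]
      rw [sum_comm]
      simp only [← mul_sum, G.sum_rate, mul_zero, sum_const_zero]
    have h1 := constant_of_derivWithin_zero (f := fun r => ∑ η, p r η) (a := t) (b := G.T)
      (fun u hu => (h0 u hu).differentiableWithinAt)
      (fun u hu => (h0 u (Set.Ico_subset_Icc_self hu)).derivWithin
        (uniqueDiffOn_Icc (hu.1.trans_lt hu.2) u (Set.Ico_subset_Icc_self hu))) u hu
    simpa [hp0] using h1
  refine ⟨p, ⟨fun η => by simp [hp0, Pi.single_apply], fun u hu η => hnn η u hu, hsum, ?_⟩⟩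
  intro φ u hu
  have h := HasDerivWithinAt.fun_sum (u := univ) fun η _ => (hder η u hu).mul_const (φ η)
  refine h.congr_deriv ?_
  have hclip : ∀ ζ, clip 1 (p u ζ) = p u ζ := fun ζ => clip_of_mem (hnn ζ u hu)
    ((single_le_sum (f := p u) (fun η _ => hnn η u hu) (mem_univ ζ)).trans (hsum u hu).le)
  simp only [hf, hclip, sum_mul]
  rw [sum_comm]
  refine sum_congr rfl fun ζ _ => ?_
  rw [show G.genX (α u) φ ζ + G.genMu (β u) φ ζ = G.gen (α u) (β u) φ ζ from rfl, gen_eq_sum,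
    mul_sum]
  exact sum_congr rfl fun η _ => by ring

theorem isLaw_law {α β : ℝ → State m N → Ctrl m} (hα : G.Admissible α) (hβ : G.Admissible β)
    {t : ℝ} (ht : t ∈ Set.Icc 0 G.T) (ξ : State m N) : G.IsLaw α β t ξ (G.law α β t ξ) :=
  Classical.epsilon_spec (G.exists_isLaw hα hβ ht ξ)

/-! ### The dynamic programming equation -/

/-- An upper bound for the running cost of the zero control. -/
def ellSum : ℝ := ∑ ξ, G.ell ξ 0

/-- An upper bound for the value function at time `t`. -/
def level (t : ℝ) : ℝ := ∑ ξ, G.g ξ + G.ellSum * (G.T - t)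

theorem ell_zero_nonneg (ξ : State m N) : 0 ≤ G.ell ξ 0 := G.ell_nonneg ξ 0 fun _ => le_rfl

theorem ellSum_nonneg : 0 ≤ G.ellSum := sum_nonneg fun ξ _ => G.ell_zero_nonneg ξ

theorem level_nonneg {t : ℝ} (ht : t ≤ G.T) : 0 ≤ G.level t :=
  add_nonneg (sum_nonneg fun ξ _ => G.g_nonneg ξ)
    (mul_nonneg G.ellSum_nonneg (sub_nonneg.2 ht))

theorem level_le {t : ℝ} (ht : 0 ≤ t) : G.level t ≤ G.level 0 := by
  have := G.ellSum_nonneg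
  unfold level
  gcongr

/-- The solution of the dynamic programming equation of the tagged player. -/
structure IsValueSol (β : ℝ → State m N → Ctrl m) (V : ℝ → State m N → ℝ) : Prop where
  terminal : ∀ ξ, V G.T ξ = G.g ξ
  nonneg : ∀ t ∈ Set.Icc 0 G.T, ∀ ξ, 0 ≤ V t ξ
  le_level : ∀ t ∈ Set.Icc 0 G.T, ∀ ξ, V t ξ ≤ G.level t
  deriv : ∀ t ∈ Set.Icc 0 G.T, ∀ ξ, HasDerivWithinAt (fun s => V s ξ)
    (-(G.ham ξ (incr (V t) ξ) + G.gen 0 (β t) (V t) ξ)) (Set.Icc 0 G.T) t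

/-- The Hamiltonian is only locally Lipschitz, so the unknown is truncated to `[0, level t]`. The
maximum principle then shows that the solution never leaves this range. -/
theorem exists_isValueSol {β : ℝ → State m N → Ctrl m} (hβ : G.Admissible β) :
    ∃ V, G.IsValueSol β V := by
  have hT := G.T_pos.le
  obtain ⟨B, hB⟩ := G.exists_rate_bound G.admissible_zero hβ
  set C := G.level 0 with hC
  have hC0 : 0 ≤ C := G.level_nonneg hT
  obtain ⟨K, hK0, hK⟩ := G.exists_ham_lipschitz (2 * C)
  obtain ⟨H, hH⟩ := Finite.exists_le fun ξ : State m N => |G.ham ξ 0|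
  set c : ℝ := Fintype.card (State m N) * B with hc
  have hc0 : 0 ≤ c := by positivity
  set cl : ℝ → (State m N → ℝ) → State m N → ℝ := fun t V ξ => clip (G.level t) (V ξ) with hcl
  set f : ℝ → (State m N → ℝ) → State m N → ℝ :=
    fun t V ξ => -(G.ham ξ (incr (cl t V) ξ) + G.gen 0 (β t) (cl t V) ξ) with hf
  have hlev : Continuous G.level := by unfold level; fun_prop
  have hgen : ∀ t ∈ Set.Icc 0 G.T, ∀ (φ : State m N → ℝ) ξ,
      |G.gen 0 (β t) φ ξ| ≤ c * ‖φ‖ := by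
    intro t ht φ ξ
    rw [gen_eq_sum]
    calc |∑ η, φ η * G.rate 0 (β t) ξ η|
        ≤ ∑ η, |φ η * G.rate 0 (β t) ξ η| := abs_sum_le_sum_abs _ _
      _ ≤ ∑ _η : State m N, ‖φ‖ * B := by
          gcongr with η
          rw [abs_mul]
          exact mul_le_mul (norm_le_pi_norm φ η) (hB t ht ξ η) (abs_nonneg _) (norm_nonneg _)
      _ = c * ‖φ‖ := by
          rw [sum_const, card_univ, nsmul_eq_mul, hc]; ring
  have hgensub : ∀ t (φ ψ : State m N → ℝ) ξ,
      G.gen 0 (β t) φ ξ - G.gen 0 (β t) ψ ξ = G.gen 0 (β t) (φ - ψ) ξ := by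
    intro t φ ψ ξ
    simp only [gen_eq_sum, ← sum_sub_distrib, ← sub_mul, Pi.sub_apply]
  have hclb : ∀ t ∈ Set.Icc 0 G.T, ∀ V, ‖cl t V‖ ≤ C := fun t ht V =>
    (pi_norm_le_iff_of_nonneg hC0).2 fun ξ =>
      (abs_clip_le (G.level_nonneg ht.2) _).trans (G.level_le ht.1)
  have hincb : ∀ t ∈ Set.Icc 0 G.T, ∀ V ξ, ‖incr (cl t V) ξ‖ ≤ 2 * C := fun t ht V ξ =>
    (norm_incr_le _ _).trans (by linarith [hclb t ht V])
  have hclsub : ∀ t V W, ‖cl t V - cl t W‖ ≤ ‖V - W‖ := fun t V W =>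
    (pi_norm_le_iff_of_nonneg (norm_nonneg _)).2 fun ξ =>
      (abs_clip_sub_le _ _ _).trans (norm_le_pi_norm (V - W) ξ)
  have hex : ∃ V : ℝ → State m N → ℝ, V G.T = G.g ∧ ∀ t ∈ Set.Icc 0 G.T,
      HasDerivWithinAt V (f t (V t)) (Set.Icc 0 G.T) t := by
    refine exists_solution_of_bounded_lipschitz (K := (K * 2 + c).toNNReal)
      (L := (H + K * (2 * C) + c * C).toNNReal) ?_ ?_ ?_ ⟨hT, le_rfl⟩ _
    · intro t ht
      refine LipschitzWith.of_dist_le_mul fun V W => ?_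
      rw [Real.coe_toNNReal _ (by positivity), dist_eq_norm, dist_eq_norm]
      refine (pi_norm_le_iff_of_nonneg (by positivity)).2 fun ξ => ?_
      have h1 := hK ξ _ _ (hincb t ht W ξ) (hincb t ht V ξ)
      have h2 := hgen t ht (cl t W - cl t V) ξ
      rw [← hgensub] at h2
      have h3 := norm_incr_sub_le (cl t W) (cl t V) ξ
      have h4 := hclsub t W V
      rw [norm_sub_rev W V] at h4
      have h5 : f t V ξ - f t W ξ = (G.ham ξ (incr (cl t W) ξ) - G.ham ξ (incr (cl t V) ξ))
        + (G.gen 0 (β t) (cl t W) ξ - G.gen 0 (β t) (cl t V) ξ) := by simp only [hf]; ring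
      rw [Pi.sub_apply, Real.norm_eq_abs, h5]
      refine (abs_add_le _ _).trans ?_
      have h6 : K * ‖incr (cl t W) ξ - incr (cl t V) ξ‖ ≤ K * (2 * ‖V - W‖) := by
        gcongr; linarith
      have h7 : c * ‖cl t W - cl t V‖ ≤ c * ‖V - W‖ := by gcongr
      linarith
    · intro V
      refine continuousOn_pi.2 fun ξ => ?_
      have hclc : ∀ ξ, Continuous fun t => cl t V ξ := fun ξ => by
        simp only [hcl, clip]; fun_prop
      refine ContinuousOn.neg (ContinuousOn.add ?_ ?_)
      · refine ((G.continuous_ham ξ).comp (continuous_pi fun i => ?_)).continuousOn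
        exact (hclc _).sub (hclc _)
      · exact G.continuousOn_gen G.admissible_zero.continuousOn hβ.continuousOn
          (fun ξ => (hclc ξ).continuousOn) ξ
    · intro t ht V
      refine (pi_norm_le_iff_of_nonneg (NNReal.coe_nonneg _)).2 fun ξ => ?_
      refine le_trans ?_ (Real.le_coe_toNNReal _)
      have h1 := hK ξ _ 0 (hincb t ht V ξ) (by simpa using hC0)
      have h2 := hgen t ht (cl t V) ξ
      rw [sub_zero] at h1
      have h3 := abs_add_le (G.ham ξ (incr (cl t V) ξ) - G.ham ξ 0) (G.ham ξ 0)
      rw [sub_add_cancel] at h3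
      have h4 : K * ‖incr (cl t V) ξ‖ ≤ K * (2 * C) := by gcongr; exact hincb t ht V ξ
      have h5 : c * ‖cl t V‖ ≤ c * C := by gcongr; exact hclb t ht V
      simp only [hf, norm_neg, Real.norm_eq_abs]
      refine (abs_add_le _ _).trans ?_
      linarith [hH ξ]
  obtain ⟨V, hVT, hV⟩ := hex
  have hder : ∀ ξ, ∀ t ∈ Set.Icc 0 G.T,
      HasDerivWithinAt (fun s => V s ξ) (f t (V t) ξ) (Set.Icc 0 G.T) t := fun ξ t ht =>
    hasDerivWithinAt_pi.1 (hV t ht) ξ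
  have h0 : ∀ (ξ : State m N) i, 0 ≤ (0 : State m N → Ctrl m) ξ i := fun _ _ => le_rfl
  have hnn : ∀ ξ, ∀ t ∈ Set.Icc 0 G.T, 0 ≤ V t ξ := by
    intro ξ
    refine nonneg_of_deriv_nonpos_of_neg (hder ξ) (by rw [hVT]; exact G.g_nonneg ξ) ?_
    intro t ht hneg
    -- At a negative value the truncated function is minimal at `ξ`, so the generator and the
    -- Hamiltonian are both nonnegative there.
    have hmin : ∀ η, cl t (V t) ξ ≤ cl t (V t) η := fun η => by
      simp only [hcl]; rw [clip_of_nonpos hneg.le]; exact clip_nonneg _ _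
    have h1 := G.gen_nonneg_of_min h0 (hβ.1 t ht) hmin
    have h2 : 0 ≤ G.ham ξ (incr (cl t (V t)) ξ) := by
      refine add_nonneg (G.ell_nonneg _ _ (G.alphaHat_nonneg _ _)) (sum_nonneg fun i _ => ?_)
      exact mul_nonneg (mul_nonneg (G.alphaHat_nonneg _ _ i) (G.lam1_nonneg _ _))
        (sub_nonneg.2 (hmin _))
    simp only [hf]; linarith
  have hle : ∀ ξ, ∀ t ∈ Set.Icc 0 G.T, 0 ≤ G.level t - V t ξ := by
    intro ξ
    have hlevd : ∀ t, HasDerivWithinAt G.level (-G.ellSum) (Set.Icc 0 G.T) t := by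
      intro t
      have h := (((hasDerivWithinAt_id t (Set.Icc 0 G.T)).const_sub G.T).const_mul
        G.ellSum).const_add (∑ ξ, G.g ξ)
      exact h.congr_deriv (by ring)
    refine nonneg_of_deriv_nonpos_of_neg (fun t ht => (hlevd t).sub (hder ξ t ht)) ?_ ?_
    · rw [hVT, level, sub_self, mul_zero, add_zero, sub_nonneg]
      exact single_le_sum (f := G.g) (fun ξ _ => G.g_nonneg ξ) (mem_univ ξ)
    · intro t ht hneg
      -- Above the level the truncated function is maximal at `ξ`. Comparison with the zero control
      -- bounds the Hamiltonian by `ℓ(ξ,0) ≤ ellSum`, the rate at which the level decreases.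
      have hmax : ∀ η, cl t (V t) η ≤ cl t (V t) ξ := fun η => by
        have hl := G.level_nonneg ht.2
        simp only [hcl]
        rw [clip_of_le hl (sub_neg.1 hneg).le]; exact clip_le hl _
      have h1 := G.gen_nonpos_of_max h0 (hβ.1 t ht) hmax
      have h2 := G.alphaHat_le ξ (incr (cl t (V t)) ξ) (b := 0) (fun _ => le_rfl)
      have h3 : G.lin ξ 0 (incr (cl t (V t)) ξ) = 0 := by simp [lin]
      have h4 : G.ell ξ 0 ≤ G.ellSum :=
        single_le_sum (f := fun ξ => G.ell ξ 0) (fun ξ _ => G.ell_zero_nonneg ξ) (mem_univ ξ)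
      simp only [hf, ham]; linarith
  refine ⟨V, fun ξ => by rw [hVT], fun t ht ξ => hnn ξ t ht,
    fun t ht ξ => sub_nonneg.1 (hle ξ t ht), fun t ht ξ => ?_⟩
  have hclV : cl t (V t) = V t := funext fun η => clip_of_mem (hnn η t ht) (sub_nonneg.1 (hle η t ht))
  have := hder ξ t ht
  simpa only [hf, hclV] using this

theorem IsValueSol.continuousOn {G : Game m N} {β : ℝ → State m N → Ctrl m}
    {V : ℝ → State m N → ℝ} (h : G.IsValueSol β V) (ξ : State m N) :
    ContinuousOn (fun t => V t ξ) (Set.Icc 0 G.T) :=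
  fun t ht => (h.deriv t ht ξ).continuousWithinAt

theorem IsValueSol.norm_le {G : Game m N} {β : ℝ → State m N → Ctrl m}
    {V : ℝ → State m N → ℝ} (h : G.IsValueSol β V) {t : ℝ} (ht : t ∈ Set.Icc 0 G.T) :
    ‖V t‖ ≤ G.level 0 := by
  refine (pi_norm_le_iff_of_nonneg (G.level_nonneg G.T_pos.le)).2 fun ξ => ?_
  rw [Real.norm_eq_abs, abs_of_nonneg (h.nonneg t ht ξ)]
  exact (h.le_level t ht ξ).trans (G.level_le ht.1)

theorem continuousOn_incr {φ : ℝ → State m N → ℝ} {s : Set ℝ}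
    (h : ∀ ξ, ContinuousOn (fun t => φ t ξ) s) (ξ : State m N) :
    ContinuousOn (fun t => incr (φ t) ξ) s :=
  continuousOn_pi.2 fun _ => (h _).sub (h _)

/-- The optimal feedback control is Lipschitz in time. -/
theorem IsValueSol.admissible {G : Game m N} {β : ℝ → State m N → Ctrl m}
    {V : ℝ → State m N → ℝ} (h : G.IsValueSol β V) (hβ : G.Admissible β) :
    G.Admissible fun t ξ => G.alphaHat ξ (incr (V t) ξ) := by
  refine ⟨fun t _ ξ i => G.alphaHat_nonneg _ _ i, ?_⟩
  obtain ⟨L, hL⟩ := G.exists_alphaHat_lipschitz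
  have hc : ∀ ξ, ContinuousOn (fun t => -(G.ham ξ (incr (V t) ξ) + G.gen 0 (β t) (V t) ξ))
      (Set.Icc 0 G.T) := fun ξ =>
    (((G.continuous_ham ξ).comp_continuousOn (continuousOn_incr h.continuousOn ξ)).add
      (G.continuousOn_gen G.admissible_zero.continuousOn hβ.continuousOn h.continuousOn ξ)).neg
  choose B hB using fun ξ => isCompact_Icc.exists_bound_of_continuousOn (hc ξ)
  obtain ⟨D, hD⟩ := Finite.exists_le B
  have hlip : ∀ ξ, LipschitzOnWith D.toNNReal (fun t => V t ξ) (Set.Icc 0 G.T) := fun ξ =>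
    (convex_Icc 0 G.T).lipschitzOnWith_of_nnnorm_hasDerivWithin_le
      (fun t ht => h.deriv t ht ξ) fun t ht => by
        rw [← NNReal.coe_le_coe, coe_nnnorm]
        exact ((hB ξ t ht).trans (hD ξ)).trans (Real.le_coe_toNNReal _)
  refine ⟨L * (D.toNNReal + D.toNNReal), fun ξ => ?_⟩
  have hinc : LipschitzOnWith (D.toNNReal + D.toNNReal) (fun t => incr (V t) ξ)
      (Set.Icc 0 G.T) := by
    refine LipschitzOnWith.of_dist_le_mul fun s hs t ht => ?_
    refine (dist_pi_le_iff (by positivity)).2 fun i => ?_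
    exact ((hlip (ξ.1.succAbove i, ξ.2)).sub (hlip ξ)).dist_le_mul s hs t ht
  exact (hL ξ).comp_lipschitzOnWith hinc

/-! ### Verification -/

section Verification

variable {G} {α β β' : ℝ → State m N → Ctrl m} {t : ℝ} {ξ : State m N} {p : ℝ → State m N → ℝ}

theorem IsLaw.hasDerivWithinAt (h : G.IsLaw α β t ξ p) {u : ℝ} (hu : u ∈ Set.Icc t G.T)
    (η : State m N) :
    HasDerivWithinAt (fun r => p r η) (∑ ζ, p u ζ * G.rate (α u) (β u) ζ η) (Set.Icc t G.T) u := by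
  have := h.forward (Pi.single η 1) u hu
  simpa [Pi.single_apply, rate, gen] using this

theorem IsLaw.continuousOn (h : G.IsLaw α β t ξ p) (η : State m N) :
    ContinuousOn (fun u => p u η) (Set.Icc t G.T) :=
  fun _ hu => (h.hasDerivWithinAt hu η).continuousWithinAt

/-- Dynkin's formula in differential form. -/
theorem IsLaw.hasDerivWithinAt_sum (h : G.IsLaw α β t ξ p) {φ : ℝ → State m N → ℝ}
    {φ' : State m N → ℝ} {u : ℝ} (hu : u ∈ Set.Icc t G.T)
    (hφ : ∀ η, HasDerivWithinAt (fun r => φ r η) (φ' η) (Set.Icc t G.T) u) :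
    HasDerivWithinAt (fun r => ∑ η, p r η * φ r η)
      (∑ η, p u η * (φ' η + G.gen (α u) (β u) (φ u) η)) (Set.Icc t G.T) u := by
  have hd := HasDerivWithinAt.fun_sum (u := univ) fun η _ => (h.hasDerivWithinAt hu η).mul (hφ η)
  refine hd.congr_deriv ?_
  simp only [gen_eq_sum, mul_add, sum_add_distrib, sum_mul, mul_sum]
  rw [add_comm, sum_comm]
  congr 1
  exact sum_congr rfl fun ζ _ => sum_congr rfl fun η _ => by ring

theorem IsLaw.sum_le (h : G.IsLaw α β t ξ p) {u : ℝ} (hu : u ∈ Set.Icc t G.T)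
    {f : State m N → ℝ} {C : ℝ} (hf : ∀ η, f η ≤ C) : ∑ η, p u η * f η ≤ C := by
  calc ∑ η, p u η * f η ≤ ∑ η, p u η * C := by
        gcongr with η
        · exact h.nonneg u hu η
        · exact hf η
    _ = C := by rw [← sum_mul, h.sum_eq_one u hu, one_mul]

theorem continuousOn_ell {s : Set ℝ} (hs : s ⊆ Set.Icc 0 G.T) (hα : G.Admissible α)
    (η : State m N) : ContinuousOn (fun u => G.ell η (α u η)) s :=
  (G.ell_cont η).comp ((hα.continuousOn η).mono hs) fun u hu => hα.1 u (hs hu) η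

variable (G) in
/-- The integrand in the comparison of a cost with a value function. -/
def costDefect (α β β' : ℝ → State m N → Ctrl m) (V : ℝ → State m N → ℝ) (u : ℝ) (η : State m N) :
    ℝ :=
  G.gap η (α u η) (incr (V u) η) + (G.genMu (β u) (V u) η - G.genMu (β' u) (V u) η)

theorem continuousOn_costDefect {V : ℝ → State m N → ℝ} (hV : G.IsValueSol β' V)
    (hα : G.Admissible α) (hβ : G.Admissible β) (hβ' : G.Admissible β') (η : State m N) :
    ContinuousOn (fun u => G.costDefect α β β' V u η) (Set.Icc 0 G.T) := by
  have h1 : ContinuousOn (fun u => G.ham η (incr (V u) η)) (Set.Icc 0 G.T) :=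
    (G.continuous_ham η).comp_continuousOn (continuousOn_incr hV.continuousOn η)
  have h2 := continuousOn_ell subset_rfl hα η
  have h3 := hα.continuousOn
  have h4 := hβ.continuousOn
  have h5 := hβ'.continuousOn
  have h6 := hV.continuousOn
  unfold costDefect gap genMu lin incr at *
  fun_prop

/-- Since `V` solves the equation for `β'`, its drift along the chain of `α, β` is `costDefect`
minus the running cost; integrate. The argument applies to any solution of the forward equation, so
uniqueness of the law is not needed. -/
theorem cost_sub_value {V : ℝ → State m N → ℝ} (hV : G.IsValueSol β' V)
    (hα : G.Admissible α) (hβ : G.Admissible β) (hβ' : G.Admissible β')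
    (ht : t ∈ Set.Icc 0 G.T) (ξ : State m N) :
    G.J t ξ α β - V t ξ =
      ∫ u in t..G.T, ∑ η, G.law α β t ξ u η * G.costDefect α β β' V u η := by
  have hp := G.isLaw_law hα hβ ht ξ
  set p := G.law α β t ξ with hpdef
  have hsub : Set.Icc t G.T ⊆ Set.Icc 0 G.T := Set.Icc_subset_Icc_left ht.1
  have hpc := hp.continuousOn
  have hell := continuousOn_ell hsub hα
  set Φ' : ℝ → ℝ := fun u => ∑ η, p u η *
    (-(G.ham η (incr (V u) η) + G.gen 0 (β' u) (V u) η) + G.gen (α u) (β u) (V u) η) with hΦ'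
  have hder : ∀ u ∈ Set.Icc t G.T,
      HasDerivWithinAt (fun r => ∑ η, p r η * V r η) (Φ' u) (Set.Icc t G.T) u := fun u hu =>
    hp.hasDerivWithinAt_sum hu fun η => (hV.deriv u (hsub hu) η).mono hsub
  have hcell : ContinuousOn (fun u => ∑ η, p u η * G.ell η (α u η)) (Set.Icc t G.T) := by
    fun_prop
  have hcdef : ContinuousOn (fun u => ∑ η, p u η * G.costDefect α β β' V u η)
      (Set.Icc t G.T) := by
    have := fun η => (continuousOn_costDefect hV hα hβ hβ' η).mono hsub
    fun_prop
  have heq : Φ' = fun u => (∑ η, p u η * G.costDefect α β β' V u η)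
      - ∑ η, p u η * G.ell η (α u η) := by
    ext u
    rw [hΦ', ← sum_sub_distrib]
    refine sum_congr rfl fun η _ => ?_
    rw [gen, gen, G.genX_eq (α u), costDefect, gap]
    ring
  have hi1 : IntervalIntegrable (fun u => ∑ η, p u η * G.ell η (α u η)) MeasureTheory.volume
      t G.T := ContinuousOn.intervalIntegrable_of_Icc ht.2 hcell
  have hi2 : IntervalIntegrable (fun u => ∑ η, p u η * G.costDefect α β β' V u η)
      MeasureTheory.volume t G.T := ContinuousOn.intervalIntegrable_of_Icc ht.2 hcdef
  have hFTC := intervalIntegral.integral_eq_sub_of_hasDerivAt_of_le ht.2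
    (fun u hu => (hder u hu).continuousWithinAt)
    (fun u hu => (hder u (Set.Ioo_subset_Icc_self hu)).hasDerivAt (Icc_mem_nhds hu.1 hu.2))
    (by rw [heq]; exact hi2.sub hi1)
  rw [heq, intervalIntegral.integral_sub hi2 hi1] at hFTC
  have hinit : ∑ η, p t η * V t η = V t ξ := by simp [hp.init]
  have hterm : ∑ η, p G.T η * V G.T η = ∑ η, p G.T η * G.g η := by simp only [hV.terminal]
  rw [hinit, hterm] at hFTC
  rw [J, ← hpdef]
  linarith

theorem IsValueSol.le_cost {V : ℝ → State m N → ℝ} (hV : G.IsValueSol β V)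
    (hα : G.Admissible α) (hβ : G.Admissible β) (ht : t ∈ Set.Icc 0 G.T) (ξ : State m N) :
    V t ξ ≤ G.J t ξ α β := by
  rw [← sub_nonneg, cost_sub_value hV hα hβ hβ ht]
  refine intervalIntegral.integral_nonneg ht.2 fun u hu => sum_nonneg fun η _ => ?_
  refine mul_nonneg ((G.isLaw_law hα hβ ht ξ).nonneg u hu η) ?_
  rw [costDefect, sub_self, add_zero]
  exact G.gap_nonneg _ _ (hα.1 u ⟨ht.1.trans hu.1, hu.2⟩ η)

theorem IsValueSol.eq_cost {V : ℝ → State m N → ℝ} (hV : G.IsValueSol β V)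
    (hβ : G.Admissible β) (ht : t ∈ Set.Icc 0 G.T) (ξ : State m N) :
    G.J t ξ (fun t ξ => G.alphaHat ξ (incr (V t) ξ)) β = V t ξ := by
  rw [← sub_eq_zero, cost_sub_value hV (hV.admissible hβ) hβ hβ ht]
  simp [costDefect, gap_alphaHat]

theorem IsValueSol.value_eq {V : ℝ → State m N → ℝ} (hV : G.IsValueSol β V)
    (hβ : G.Admissible β) (ht : t ∈ Set.Icc 0 G.T) (ξ : State m N) :
    G.value β t ξ = V t ξ := by
  have : Nonempty {α : ℝ → State m N → Ctrl m // G.Admissible α} := ⟨⟨0, G.admissible_zero⟩⟩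
  refine le_antisymm ?_ (le_ciInf fun α => hV.le_cost α.2 hβ ht ξ)
  rw [← hV.eq_cost hβ ht ξ]
  exact ciInf_le (f := fun α : {α : ℝ → State m N → Ctrl m // G.Admissible α} => G.J t ξ α.1 β)
    ⟨V t ξ, by rintro _ ⟨α, rfl⟩; exact hV.le_cost α.2 hβ ht ξ⟩ ⟨_, hV.admissible hβ⟩

theorem isValueSol_value (hβ : G.Admissible β) : G.IsValueSol β (G.value β) := by
  obtain ⟨V, hV⟩ := G.exists_isValueSol hβ
  have heq : ∀ t ∈ Set.Icc 0 G.T, G.value β t = V t := fun t ht =>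
    funext fun ξ => hV.value_eq hβ ht ξ
  refine ⟨fun ξ => ?_, fun t ht ξ => ?_, fun t ht ξ => ?_, fun t ht ξ => ?_⟩
  · rw [heq _ ⟨G.T_pos.le, le_rfl⟩, hV.terminal]
  · rw [heq t ht]; exact hV.nonneg t ht ξ
  · rw [heq t ht]; exact hV.le_level t ht ξ
  · rw [heq t ht]
    exact (hV.deriv t ht ξ).congr (fun s hs => congrFun (heq s hs) ξ) (congrFun (heq t ht) ξ)

theorem admissible_bestResponse (hβ : G.Admissible β) : G.Admissible (G.bestResponse β) :=
  (isValueSol_value hβ).admissible hβ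

theorem value_le_cost (hα : G.Admissible α) (hβ : G.Admissible β) (ht : t ∈ Set.Icc 0 G.T)
    (ξ : State m N) : G.value β t ξ ≤ G.J t ξ α β :=
  (isValueSol_value hβ).le_cost hα hβ ht ξ

end Verification

/-! ### Stability of the value function and of the best response -/

theorem abs_genMu_sub_le (b b' : State m N → Ctrl m) (φ : State m N → ℝ) (ξ : State m N) :
    |G.genMu b φ ξ - G.genMu b' φ ξ| ≤
      (m + 1) * m * (N * G.lamSum) * (2 * ‖φ‖) * l2 (b - b') := by
  have h : ∀ z i, |(ξ.2.1 z : ℝ) * (G.lam0 (z, ξ.2.move ξ.1 z) i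
        + G.lam1 (z, ξ.2.move ξ.1 z) i * b (z, ξ.2.move ξ.1 z) i)
      * (φ (ξ.1, ξ.2.move (z.succAbove i) z) - φ ξ) - (ξ.2.1 z : ℝ) * (G.lam0 (z, ξ.2.move ξ.1 z) i
        + G.lam1 (z, ξ.2.move ξ.1 z) i * b' (z, ξ.2.move ξ.1 z) i)
      * (φ (ξ.1, ξ.2.move (z.succAbove i) z) - φ ξ)| ≤
      N * G.lamSum * l2 (b - b') * (2 * ‖φ‖) := by
    intro z i
    set ζ : State m N := (z, ξ.2.move ξ.1 z)
    set η : State m N := (ξ.1, ξ.2.move (z.succAbove i) z)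
    have e : (ξ.2.1 z : ℝ) * (G.lam0 ζ i + G.lam1 ζ i * b ζ i) * (φ η - φ ξ)
        - (ξ.2.1 z : ℝ) * (G.lam0 ζ i + G.lam1 ζ i * b' ζ i) * (φ η - φ ξ)
        = (ξ.2.1 z : ℝ) * G.lam1 ζ i * ((b - b') ζ i) * (φ η - φ ξ) := by
      simp only [Pi.sub_apply, PiLp.sub_apply]; ring
    have h1 : (ξ.2.1 z : ℝ) ≤ N := by
      exact_mod_cast (single_le_sum (fun i _ => Nat.zero_le (ξ.2.1 i)) (mem_univ z)).trans ξ.2.2.le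
    have h2 : G.lam1 ζ i ≤ G.lamSum :=
      (single_le_sum (f := fun i => G.lam1 ζ i) (fun i _ => G.lam1_nonneg ζ i)
        (mem_univ i)).trans (G.sum_lam1_le ζ)
    have h3 : |(b - b') ζ i| ≤ l2 (b - b') :=
      (PiLp.norm_apply_le ((b - b') ζ) i).trans (norm_le_l2 (b - b') ζ)
    have h4 : |φ η - φ ξ| ≤ 2 * ‖φ‖ := by
      refine (norm_sub_le (φ η) (φ ξ)).trans ?_
      linarith [norm_le_pi_norm φ η, norm_le_pi_norm φ ξ]
    have := G.lam1_nonneg ζ i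
    have := l2_nonneg (b - b')
    have := G.lamSum_nonneg
    rw [e, abs_mul, abs_mul, abs_mul, abs_of_nonneg (G.lam1_nonneg ζ i), Nat.abs_cast]
    gcongr
  simp only [genMu, ← sum_sub_distrib]
  calc _ ≤ ∑ z : Fin (m + 1), ∑ i : Fin m, N * G.lamSum * l2 (b - b') * (2 * ‖φ‖) := by
        refine (abs_sum_le_sum_abs _ _).trans (sum_le_sum fun z _ => ?_)
        exact (abs_sum_le_sum_abs _ _).trans (sum_le_sum fun i _ => h z i)
    _ = _ := by simp; ring

/-- Against `β`, play the control that is optimal against `β'`: the gap vanishes and only the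
difference of the two generators of the other players remains. Values are bounded by `level 0`
whatever the controls, so `K` is uniform. -/
theorem exists_value_sub_le :
    ∃ K, 0 ≤ K ∧ ∀ β β', G.Admissible β → G.Admissible β' → ∀ t ∈ Set.Icc 0 G.T, ∀ ξ,
      |G.value β t ξ - G.value β' t ξ| ≤ K * ∫ s in t..G.T, l2 (β' s - β s) := by
  have hΛ := G.lamSum_nonneg
  have hlev := G.level_nonneg G.T_pos.le
  set K : ℝ := (m + 1) * m * (N * G.lamSum) * (2 * G.level 0) with hK
  have key : ∀ β β', G.Admissible β → G.Admissible β' → ∀ t ∈ Set.Icc 0 G.T, ∀ ξ,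
      G.value β t ξ - G.value β' t ξ ≤ K * ∫ s in t..G.T, l2 (β s - β' s) := by
    intro β β' hβ hβ' t ht ξ
    have hV := isValueSol_value hβ'
    have hsub : Set.Icc t G.T ⊆ Set.Icc 0 G.T := Set.Icc_subset_Icc_left ht.1
    have hα := hV.admissible hβ'
    have hp := G.isLaw_law hα hβ ht ξ
    have h1 := value_le_cost hα hβ ht ξ
    have h2 := cost_sub_value hV hα hβ hβ' ht ξ
    refine (sub_le_sub_right h1 _).trans (h2.le.trans ?_)
    rw [← intervalIntegral.integral_const_mul]
    refine intervalIntegral.integral_mono_on ht.2 ?_ ?_ ?_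
    · refine ContinuousOn.intervalIntegrable_of_Icc ht.2 ?_
      have h3 := hp.continuousOn
      have h4 := fun η => (continuousOn_costDefect hV hα hβ hβ' η).mono hsub
      fun_prop
    · refine ContinuousOn.intervalIntegrable_of_Icc ht.2 (continuousOn_const.mul ?_)
      refine continuous_l2.comp_continuousOn (continuousOn_pi.2 fun η => ?_)
      exact ((hβ.continuousOn η).sub (hβ'.continuousOn η)).mono hsub
    · intro u hu
      refine hp.sum_le hu fun η => ?_
      rw [costDefect, gap_alphaHat, zero_add]
      refine (le_abs_self _).trans ((G.abs_genMu_sub_le _ _ _ _).trans ?_)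
      have := l2_nonneg (β u - β' u)
      have := hV.norm_le (hsub hu)
      rw [hK]
      gcongr
  refine ⟨K, by positivity, fun β β' hβ hβ' t ht ξ => abs_le.2 ⟨?_, ?_⟩⟩
  · have := key β' β hβ' hβ t ht ξ
    linarith
  · have := key β β' hβ hβ' t ht ξ
    simpa only [l2_sub_comm (β _)] using this

/-- Integrate `(f - c)² ≥ 0` with `c` the mean of `f`. -/
theorem sq_integral_le {f : ℝ → ℝ} {a b : ℝ} (hab : a ≤ b) (hf : ContinuousOn f (Set.Icc a b)) :
    (∫ s in a..b, f s) ^ 2 ≤ (b - a) * ∫ s in a..b, f s ^ 2 := by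
  rcases hab.eq_or_lt with rfl | hlt
  · simp
  set I := ∫ s in a..b, f s with hI
  have hi1 : IntervalIntegrable f MeasureTheory.volume a b := hf.intervalIntegrable_of_Icc hab
  have hi2 : IntervalIntegrable (fun s => f s ^ 2) MeasureTheory.volume a b :=
    (hf.pow 2).intervalIntegrable_of_Icc hab
  set c := I / (b - a) with hc
  have h0 : 0 ≤ ∫ s in a..b, (f s ^ 2 - (2 * c * f s - c ^ 2)) :=
    intervalIntegral.integral_nonneg hab fun s _ => by nlinarith [sq_nonneg (f s - c)]
  rw [intervalIntegral.integral_sub hi2 ((hi1.const_mul _).sub (by simp)),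
    intervalIntegral.integral_sub (hi1.const_mul _) (by simp),
    intervalIntegral.integral_const_mul, intervalIntegral.integral_const, ← hI, smul_eq_mul] at h0
  have hba : 0 < b - a := sub_pos.2 hlt
  have h1 : I = c * (b - a) := by rw [hc]; field_simp
  rw [h1] at h0 ⊢
  nlinarith

theorem exists_isStabilityConst : ∃ c, G.IsStabilityConst c := by
  obtain ⟨K, hK0, hK⟩ := G.exists_value_sub_le
  have hT := G.T_pos
  set n : ℝ := (Fintype.card (State m N) : ℝ) with hn
  have hn0 : 0 ≤ n := Nat.cast_nonneg _
  -- The summand `1` only makes the constant strictly positive.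
  refine ⟨n * K ^ 2 * G.T + 1, by positivity, fun β β' hβ hβ' t ht => ?_⟩
  have hc : ContinuousOn (fun s => l2 (β' s - β s)) (Set.Icc t G.T) := by
    refine continuous_l2.comp_continuousOn (continuousOn_pi.2 fun η => ?_)
    exact ((hβ'.continuousOn η).sub (hβ.continuousOn η)).mono (Set.Icc_subset_Icc_left ht.1)
  have h1 := sq_integral_le ht.2 hc
  set I := ∫ s in t..G.T, l2 (β' s - β s)
  set S := ∫ s in t..G.T, l2 (β' s - β s) ^ 2
  have hS : 0 ≤ S := intervalIntegral.integral_nonneg ht.2 fun s _ => sq_nonneg _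
  have h2 : l2 (G.value β t - G.value β' t) ^ 2 ≤ n * (K * I) ^ 2 := by
    rw [l2_sq]
    calc ∑ ξ, ‖(G.value β t - G.value β' t) ξ‖ ^ 2 ≤ ∑ _ξ : State m N, (K * I) ^ 2 := by
          gcongr with ξ
          exact hK β β' hβ hβ' t ht ξ
      _ = n * (K * I) ^ 2 := by rw [sum_const, card_univ, nsmul_eq_mul]
  have h3 : (G.T - t) * S ≤ G.T * S := by
    gcongr; linarith [ht.1]
  calc l2 (G.value β t - G.value β' t) ^ 2 ≤ n * (K * I) ^ 2 := h2
    _ = n * K ^ 2 * I ^ 2 := by ring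
    _ ≤ n * K ^ 2 * (G.T * S) := by gcongr; exact h1.trans h3
    _ ≤ (n * K ^ 2 * G.T + 1) * S := by linarith

theorem exists_isResponseConst : ∃ c₀, G.IsResponseConst c₀ := by
  obtain ⟨L, hL⟩ := G.exists_alphaHat_lipschitz
  refine ⟨√(Fintype.card (State m N)) * (L * 2) + 1, by positivity,
    fun β β' hβ hβ' t ht => ?_⟩
  set δ := l2 (G.value β t - G.value β' t) with hδ
  have hδ0 : 0 ≤ δ := l2_nonneg _
  have h : ∀ ξ, ‖(G.bestResponse β t - G.bestResponse β' t) ξ‖ ≤ L * 2 * δ := by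
    intro ξ
    have h1 := (hL ξ).dist_le_mul (incr (G.value β t) ξ) (incr (G.value β' t) ξ)
    rw [dist_eq_norm, dist_eq_norm] at h1
    have h2 := (norm_incr_sub_le (G.value β t) (G.value β' t) ξ).trans
      (mul_le_mul_of_nonneg_left (pi_norm_le_l2 _) zero_le_two)
    calc _ ≤ (L : ℝ) * ‖incr (G.value β t) ξ - incr (G.value β' t) ξ‖ := h1
      _ ≤ L * (2 * δ) := by gcongr
      _ = L * 2 * δ := by ring
  have h3 := l2_le_of_forall (by positivity) h
  linarith

variable {G}

/-! ### The Picard iteration -/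

/-- Continuity on a compact interval is essential here: `sSup` of an unbounded set is `0` by
convention. -/
theorem l2_le_sNorm {ψ : ℝ → State m N → Ctrl m} (hψ : G.Admissible ψ) {t : ℝ}
    (ht : t ∈ Set.Icc 0 G.T) : l2 (ψ t) ≤ G.sNorm ψ := by
  have hc : ContinuousOn (fun t => l2 (ψ t)) (Set.Icc 0 G.T) :=
    continuous_l2.comp_continuousOn (continuousOn_pi.2 hψ.continuousOn)
  exact le_csSup (isCompact_Icc.image_of_continuousOn hc).bddAbove ⟨t, ht, rfl⟩

theorem sNorm_nonneg {ψ : ℝ → State m N → Ctrl m} (hψ : G.Admissible ψ) : 0 ≤ G.sNorm ψ :=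
  (l2_nonneg _).trans (l2_le_sNorm hψ ⟨le_rfl, G.T_pos.le⟩)

theorem admissible_picard {β₀ : ℝ → State m N → Ctrl m} (h₀ : G.Admissible β₀) :
    ∀ n, G.Admissible (G.picard β₀ n)
  | 0 => h₀
  | n + 1 => admissible_bestResponse (admissible_picard h₀ n)

theorem admissible_picardErr {β₀ : ℝ → State m N → Ctrl m} {ε : ℕ → ℝ → State m N → Ctrl m}
    (h₀ : G.Admissible β₀) (hε : ∀ n ≥ 1, G.Admissible (ε n)) :
    ∀ n, G.Admissible (G.picardErr β₀ ε n)
  | 0 => h₀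
  | n + 1 => (admissible_bestResponse (admissible_picardErr h₀ hε n)).add (hε _ n.succ_pos)

theorem continuousOn_l2_sub_sq {F : Type*} [NormedAddCommGroup F] {φ ψ : ℝ → State m N → F}
    {s : Set ℝ} (hφ : ∀ ξ, ContinuousOn (fun t => φ t ξ) s)
    (hψ : ∀ ξ, ContinuousOn (fun t => ψ t ξ) s) :
    ContinuousOn (fun t => l2 (φ t - ψ t) ^ 2) s :=
  (continuous_l2.comp_continuousOn
    (continuousOn_pi.2 fun ξ => (hφ ξ).sub (hψ ξ))).pow 2

theorem integral_sub_pow_div_factorial (T t : ℝ) (j : ℕ) :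
    ∫ s in t..T, (T - s) ^ j / (j.factorial : ℝ) = (T - t) ^ (j + 1) / ((j + 1).factorial : ℝ) := by
  rw [intervalIntegral.integral_div,
    intervalIntegral.integral_comp_sub_left (fun x => x ^ j) T, integral_pow, sub_self,
    Nat.factorial_succ]
  push_cast
  have : (j.factorial : ℝ) ≠ 0 := Nat.cast_ne_zero.2 (Nat.factorial_ne_zero j)
  have : (j : ℝ) + 1 ≠ 0 := by positivity
  field_simp
  simp

theorem two_le_chat (c₀ : ℝ) : 2 ≤ chat c₀ := by
  unfold chat; linarith [le_max_right (c₀ ^ 2) 1]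

theorem sum_Icc_one {f : ℕ → ℝ} (n : ℕ) : ∑ k ∈ Icc 1 n, f k = ∑ j ∈ range n, f (j + 1) := by
  induction n with
  | zero => simp
  | succ n ih => rw [sum_Icc_succ_top (by omega), ih, sum_range_succ]

section Bounds

variable {c₀ c : ℝ} {β₀ : ℝ → State m N → Ctrl m} {ε : ℕ → ℝ → State m N → Ctrl m}

theorem gammaBound_eq (c₀ c : ℝ) (ε : ℕ → ℝ → State m N → Ctrl m) (n : ℕ) (t : ℝ) :
    G.GammaBound c₀ c ε n t = chat c₀ * ∑ j ∈ range n,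
      (c * chat c₀) ^ j * (G.T - t) ^ j / (j.factorial : ℝ) * G.sNorm (ε (n - j)) ^ 2 := by
  rw [GammaBound, sum_Icc_one]
  simp only [Nat.add_sub_cancel, Nat.add_sub_add_right]

theorem qBound_succ_eq (c₀ c : ℝ) (ε : ℕ → ℝ → State m N → Ctrl m) (n : ℕ) (t : ℝ) :
    G.QBound c₀ c ε (n + 1) t = ∑ j ∈ range n,
      (c * chat c₀) ^ (j + 1) * (G.T - t) ^ (j + 1) / ((j + 1).factorial : ℝ)
        * G.sNorm (ε (n - j)) ^ 2 := by
  rw [QBound, Nat.add_sub_cancel, sum_Icc_one]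
  simp only [Nat.add_sub_add_right]

/-- The term `j = 0` is the newest error; the remaining ones form `QBound`. -/
theorem gammaBound_succ (c₀ c : ℝ) (ε : ℕ → ℝ → State m N → Ctrl m) (n : ℕ) (t : ℝ) :
    G.GammaBound c₀ c ε (n + 1) t =
      chat c₀ * (G.QBound c₀ c ε (n + 1) t + G.sNorm (ε (n + 1)) ^ 2) := by
  rw [gammaBound_eq, qBound_succ_eq, sum_range_succ']
  simp only [Nat.add_sub_add_right]
  simp

theorem continuous_gammaBound (c₀ c : ℝ) (ε : ℕ → ℝ → State m N → Ctrl m) (n : ℕ) :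
    Continuous (G.GammaBound c₀ c ε n) := by
  unfold GammaBound; fun_prop

/-- Integration turns `(T-s)^j/j!` into the next such term, and `c` with the prefactor `chat c₀`
supplies the missing power. -/
theorem integral_gammaBound (c₀ c : ℝ) (ε : ℕ → ℝ → State m N → Ctrl m) (n : ℕ) (t : ℝ) :
    c * ∫ s in t..G.T, G.GammaBound c₀ c ε n s = G.QBound c₀ c ε (n + 1) t := by
  simp only [gammaBound_eq, qBound_succ_eq]
  rw [intervalIntegral.integral_const_mul, intervalIntegral.integral_finsetSum]
  · rw [← mul_assoc, mul_sum]
    refine sum_congr rfl fun j _ => ?_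
    have : ∀ s, (c * chat c₀) ^ j * (G.T - s) ^ j / (j.factorial : ℝ) * G.sNorm (ε (n - j)) ^ 2
        = (c * chat c₀) ^ j * G.sNorm (ε (n - j)) ^ 2 * ((G.T - s) ^ j / (j.factorial : ℝ)) :=
      fun s => by ring
    simp only [this]
    rw [intervalIntegral.integral_const_mul, integral_sub_pow_div_factorial]
    ring
  · intro j _
    exact Continuous.intervalIntegrable (by fun_prop) _ _

/-- The response estimate, then `(x + y)² ≤ 2x² + 2y²`; this is the origin of `ĉ₀`. -/
theorem gam_succ_le (hc₀ : G.IsResponseConst c₀) (h₀ : G.Admissible β₀)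
    (hε : ∀ n ≥ 1, G.Admissible (ε n)) (n : ℕ) {t : ℝ} (ht : t ∈ Set.Icc 0 G.T) :
    G.gam β₀ ε (n + 1) t ≤ chat c₀ * (G.q β₀ ε (n + 1) t + G.sNorm (ε (n + 1)) ^ 2) := by
  have e : G.picardErr β₀ ε (n + 1) t - G.picard β₀ (n + 1) t =
      (G.bestResponse (G.picardErr β₀ ε n) t - G.bestResponse (G.picard β₀ n) t)
        + ε (n + 1) t := by
    simp only [picardErr, picard, Pi.add_apply]; abel
  have h1 := hc₀.2 _ _ (admissible_picardErr h₀ hε n) (admissible_picard h₀ n) t ht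
  have h2 := l2_le_sNorm (hε (n + 1) n.succ_pos) ht
  rw [gam, e]
  have h3 := l2_add_le (G.bestResponse (G.picardErr β₀ ε n) t - G.bestResponse (G.picard β₀ n) t)
    (ε (n + 1) t)
  have hq : G.q β₀ ε (n + 1) t =
    l2 (G.value (G.picardErr β₀ ε n) t - G.value (G.picard β₀ n) t) ^ 2 := rfl
  rw [hq]
  set x := l2 (G.value (G.picardErr β₀ ε n) t - G.value (G.picard β₀ n) t)
  set y := G.sNorm (ε (n + 1))
  have h4 := (h3.trans (add_le_add h1 h2))
  calc _ ≤ (c₀ * x + y) ^ 2 := by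
        gcongr; exact l2_nonneg _
    _ ≤ 2 * (c₀ ^ 2 * x ^ 2 + 1 * y ^ 2) := by nlinarith [sq_nonneg (c₀ * x - y)]
    _ ≤ 2 * (max (c₀ ^ 2) 1 * x ^ 2 + max (c₀ ^ 2) 1 * y ^ 2) := by
        gcongr
        · exact le_max_left _ _
        · exact le_max_right _ _
    _ = _ := by rw [chat]; ring

/-- Stability carries the bound from `γ^(n)` to `q^(n+1)`, and `gam_succ_le` from there to
`γ^(n+1)`. The start is `γ^(0) = 0`, as both iterations begin with `β₀`. -/
theorem gam_le_and_q_succ_le (hc₀ : G.IsResponseConst c₀) (hc : G.IsStabilityConst c)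
    (h₀ : G.Admissible β₀) (hε : ∀ n ≥ 1, G.Admissible (ε n)) (n : ℕ) :
    (∀ t ∈ Set.Icc 0 G.T, G.gam β₀ ε n t ≤ G.GammaBound c₀ c ε n t) ∧
      ∀ t ∈ Set.Icc 0 G.T, G.q β₀ ε (n + 1) t ≤ G.QBound c₀ c ε (n + 1) t := by
  have hq : ∀ n, (∀ t ∈ Set.Icc 0 G.T, G.gam β₀ ε n t ≤ G.GammaBound c₀ c ε n t) →
      ∀ t ∈ Set.Icc 0 G.T, G.q β₀ ε (n + 1) t ≤ G.QBound c₀ c ε (n + 1) t := by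
    intro n hn t ht
    have hb := admissible_picardErr h₀ hε n
    have hb' := admissible_picard h₀ n
    have hsub : Set.Icc t G.T ⊆ Set.Icc 0 G.T := Set.Icc_subset_Icc_left ht.1
    refine (hc.2 _ _ hb hb' t ht).trans ?_
    rw [← integral_gammaBound]
    refine mul_le_mul_of_nonneg_left ?_ hc.1.le
    refine intervalIntegral.integral_mono_on ht.2 ?_ ?_ fun s hs => ?_
    · exact ((continuousOn_l2_sub_sq hb'.continuousOn hb.continuousOn).mono
        hsub).intervalIntegrable_of_Icc ht.2
    · exact (continuous_gammaBound c₀ c ε n).intervalIntegrable _ _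
    · rw [l2_sub_comm]
      exact hn s (hsub hs)
  suffices h : ∀ t ∈ Set.Icc 0 G.T, G.gam β₀ ε n t ≤ G.GammaBound c₀ c ε n t from ⟨h, hq n h⟩
  induction n with
  | zero => intro t _; simp [gam, picardErr, picard, GammaBound]
  | succ n ih =>
    intro t ht
    refine (gam_succ_le hc₀ h₀ hε n ht).trans ?_
    rw [gammaBound_succ]
    have := two_le_chat c₀
    gcongr
    exact hq n ih t ht

theorem gammaBound_le (hc : 0 < c) (hε : ∀ n ≥ 1, G.Admissible (ε n)) {e : ℝ}
    (he : ∀ n ≥ 1, G.sNorm (ε n) ≤ e) (n : ℕ) {t : ℝ} (ht : t ∈ Set.Icc 0 G.T) :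
    G.GammaBound c₀ c ε n t ≤ chat c₀ * Real.exp (c * chat c₀ * G.T) * e ^ 2 := by
  have h2 := two_le_chat c₀
  have hT := G.T_pos
  have hTt : 0 ≤ G.T - t := sub_nonneg.2 ht.2
  rw [gammaBound_eq, mul_assoc]
  refine mul_le_mul_of_nonneg_left ?_ (by linarith)
  calc _ ≤ ∑ j ∈ range n, (c * chat c₀ * G.T) ^ j / (j.factorial : ℝ) * e ^ 2 := by
        refine sum_le_sum fun j hj => ?_
        -- Only errors with index at least `1` are controlled; `ε 0` never occurs.
        have hj' : 1 ≤ n - j := by have := mem_range.1 hj; omega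
        have := sNorm_nonneg (hε _ hj')
        rw [mul_pow (c * chat c₀) G.T]
        gcongr
        · linarith [ht.1]
        · exact he _ hj'
    _ ≤ _ := by
        rw [← sum_mul]
        gcongr
        exact Real.sum_le_exp_of_nonneg (by positivity) n

/-- The uniform bound for the propagated errors. -/
theorem gam_add_q_le (hc₀ : G.IsResponseConst c₀) (hc : G.IsStabilityConst c)
    (h₀ : G.Admissible β₀) (hε : ∀ n ≥ 1, G.Admissible (ε n)) {e : ℝ}
    (he : ∀ n ≥ 1, G.sNorm (ε n) ≤ e) {n : ℕ} (hn : 1 ≤ n) {s t : ℝ} (hs : s ∈ Set.Icc 0 G.T)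
    (ht : t ∈ Set.Icc 0 G.T) :
    G.gam β₀ ε n s + G.q β₀ ε n t ≤ 2 * (chat c₀ * Real.exp (c * chat c₀ * G.T)) * e ^ 2 := by
  obtain ⟨k, rfl⟩ : ∃ k, n = k + 1 := ⟨n - 1, by omega⟩
  have h1 := (gam_le_and_q_succ_le hc₀ hc h₀ hε (k + 1)).1 s hs
  have h2 := (gam_le_and_q_succ_le hc₀ hc h₀ hε k).2 t ht
  have h3 := gammaBound_le (c₀ := c₀) hc.1 hε he (k + 1) hs
  have h4 := gammaBound_le (c₀ := c₀) hc.1 hε he (k + 1) ht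
  have h5 := gammaBound_succ (G := G) c₀ c ε k t
  have h6 := two_le_chat c₀
  have h7 : 0 ≤ G.q β₀ ε (k + 1) t := sq_nonneg _
  -- Since `chat c₀ ≥ 1`, the bound for `γ` also serves for `q`; hence the factor `2`.
  have h8 : G.QBound c₀ c ε (k + 1) t ≤ G.GammaBound c₀ c ε (k + 1) t := by
    rw [h5]
    nlinarith [sq_nonneg (G.sNorm (ε (k + 1)))]
  linarith

/-- Convergence of the value functions of the exact Picard iteration. -/
theorem picard_value_sub_le (hc₀ : G.IsResponseConst c₀) (hc : G.IsStabilityConst c)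
    (h₀ : G.Admissible β₀) (n : ℕ) {t : ℝ} (ht : t ∈ Set.Icc 0 G.T) :
    l2 (G.value (G.picard β₀ (n + 1)) t - G.value (G.picard β₀ n) t) ^ 2 ≤
      (√(Fintype.card (State m N)) * (2 * G.level 0)) ^ 2 * (c * c₀ ^ 2) ^ n *
        ((G.T - t) ^ n / (n.factorial : ℝ)) := by
  have hlev := G.level_nonneg G.T_pos.le
  induction n generalizing t with
  | zero =>
    simp only [pow_zero, Nat.factorial_zero, Nat.cast_one, div_one, mul_one]
    gcongr
    · exact l2_nonneg _
    -- All values lie below `level 0`, so the start of the induction, and later the threshold `n₀`,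
    -- do not depend on `β₀`.
    refine l2_le_of_forall (by positivity) fun ξ => (norm_sub_le _ _).trans ?_
    have h : ∀ n, ‖G.value (G.picard β₀ n) t ξ‖ ≤ G.level 0 := fun n =>
      (norm_le_pi_norm _ ξ).trans ((isValueSol_value (admissible_picard h₀ n)).norm_le ht)
    linarith [h (0 + 1), h 0]
  | succ n ih =>
    have hA := admissible_picard h₀
    have hsub : Set.Icc t G.T ⊆ Set.Icc 0 G.T := Set.Icc_subset_Icc_left ht.1
    refine (hc.2 _ _ (hA (n + 1 + 1)) (hA (n + 1)) t ht).trans ?_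
    set B := (√(Fintype.card (State m N)) * (2 * G.level 0)) ^ 2
    have h1 : ∫ s in t..G.T, l2 (G.picard β₀ (n + 1) s - G.picard β₀ (n + 1 + 1) s) ^ 2 ≤
        ∫ s in t..G.T, c₀ ^ 2 * (B * (c * c₀ ^ 2) ^ n) *
          ((G.T - s) ^ n / (n.factorial : ℝ)) := by
      refine intervalIntegral.integral_mono_on ht.2 ?_ ?_ fun s hs => ?_
      · exact ((continuousOn_l2_sub_sq (hA _).continuousOn (hA _).continuousOn).mono
          hsub).intervalIntegrable_of_Icc ht.2
      · exact Continuous.intervalIntegrable (by fun_prop) _ _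
      · have h2 := hc₀.2 _ _ (hA (n + 1)) (hA n) s (hsub hs)
        rw [l2_sub_comm]
        calc _ ≤ (c₀ * l2 (G.value (G.picard β₀ (n + 1)) s - G.value (G.picard β₀ n) s)) ^ 2 := by
              gcongr
              · exact l2_nonneg _
              · exact h2
          _ = c₀ ^ 2 * l2 (G.value (G.picard β₀ (n + 1)) s - G.value (G.picard β₀ n) s) ^ 2 := by
              ring
          _ ≤ c₀ ^ 2 * (B * (c * c₀ ^ 2) ^ n * ((G.T - s) ^ n / (n.factorial : ℝ))) := by
              gcongr; exact ih (hsub hs)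
          _ = _ := by ring
    rw [intervalIntegral.integral_const_mul, integral_sub_pow_div_factorial] at h1
    calc _ ≤ c * (c₀ ^ 2 * (B * (c * c₀ ^ 2) ^ n) *
          ((G.T - t) ^ (n + 1) / ((n + 1).factorial : ℝ))) := mul_le_mul_of_nonneg_left h1 hc.1.le
      _ = _ := by ring

end Bounds

/-! ### Approximate equilibria -/

/-- A perturbed best response to a control with almost the same value function is almost a
best response to itself. -/
theorem exists_isApproxMPE_const (G : Game m N) :
    ∃ K, 0 ≤ K ∧ ∀ (β ψ : ℝ → State m N → Ctrl m) (e r : ℝ), G.Admissible β → G.Admissible ψ →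
      G.sNorm ψ ≤ e → e ≤ 1 →
      (∀ t ∈ Set.Icc 0 G.T, l2 (G.value β t - G.value (G.bestResponse β + ψ) t) ≤ r) →
      G.IsApproxMPE (K * (e + 2 * r)) (G.bestResponse β + ψ) := by
  obtain ⟨K, hK0, hK⟩ := G.exists_gap_perturb_le (2 * G.level 0)
  have hT := G.T_pos
  refine ⟨G.T * K, by positivity, fun β ψ e r hβ hψ hψe he1 hr => ?_⟩
  set β' := G.bestResponse β + ψ with hβ'def
  have hβ' : G.Admissible β' := (admissible_bestResponse hβ).add hψ
  have he0 : 0 ≤ e := (sNorm_nonneg hψ).trans hψe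
  have hr0 : 0 ≤ r := (l2_nonneg _).trans (hr 0 ⟨le_rfl, hT.le⟩)
  have hV := isValueSol_value hβ
  have hV' := isValueSol_value hβ'
  refine ⟨hβ', fun t ht ξ α hα => ?_⟩
  have hsub : Set.Icc t G.T ⊆ Set.Icc 0 G.T := Set.Icc_subset_Icc_left ht.1
  have h1 := value_le_cost hα hβ' ht ξ
  have h2 := cost_sub_value hV' hβ' hβ' hβ' ht ξ
  have hp := G.isLaw_law hβ' hβ' ht ξ
  have hinc : ∀ {γ : ℝ → State m N → Ctrl m}, G.IsValueSol γ (G.value γ) →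
      ∀ u ∈ Set.Icc 0 G.T, ∀ η, ‖incr (G.value γ u) η‖ ≤ 2 * G.level 0 := fun h u hu η =>
    (norm_incr_le _ _).trans (by linarith [h.norm_le hu])
  -- With all three controls equal, the defect is the gap of `α̂(p) + ψ` at the increments `p'` of
  -- its own value, where `p` are the increments of the value of `β`.
  have h3 : ∫ u in t..G.T, ∑ η, G.law β' β' t ξ u η *
      G.costDefect β' β' β' (G.value β') u η ≤ ∫ _u in t..G.T, K * (e + 2 * r) := by
    refine intervalIntegral.integral_mono_on ht.2 ?_ (by simp) fun u hu => hp.sum_le hu fun η => ?_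
    · refine ContinuousOn.intervalIntegrable_of_Icc ht.2 ?_
      have h4 := hp.continuousOn
      have h5 := fun η => (continuousOn_costDefect hV' hβ' hβ' hβ' η).mono hsub
      fun_prop
    · have hu' := hsub hu
      have he : ‖ψ u η‖ ≤ e := (norm_le_l2 _ η).trans ((l2_le_sNorm hψ hu').trans hψe)
      rw [costDefect, sub_self, add_zero]
      refine (hK η (incr (G.value β u) η) _ (ψ u η) (hinc hV u hu' η) (hinc hV' u hu' η)
        (hψ.1 u hu' η) (he.trans he1)).trans ?_
      gcongr
      refine (norm_incr_sub_le _ _ η).trans ?_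
      gcongr
      exact (pi_norm_le_l2 _).trans (hr u hu')
  rw [intervalIntegral.integral_const, smul_eq_mul] at h3
  have h6 : (G.T - t) * (K * (e + 2 * r)) ≤ G.T * (K * (e + 2 * r)) := by
    gcongr; linarith [ht.1]
  linarith

/-- The values of `β̂^(k)` and `β̂^(k+1)` are compared through the exact ones: the two outer
differences are propagated errors, the middle one is small once `k` is large. -/
theorem exists_picardErr_isApproxMPE {c₀ c c' : ℝ} (hc₀ : G.IsResponseConst c₀)
    (hc : G.IsStabilityConst c) (hc'0 : 0 < c')
    (hc' : ∀ (β₀ : ℝ → State m N → Ctrl m) (ε : ℕ → ℝ → State m N → Ctrl m) (e : ℝ),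
      G.Admissible β₀ → (∀ n ≥ 1, G.Admissible (ε n)) → (∀ n ≥ 1, G.sNorm (ε n) ≤ e) →
      ∀ n ≥ 1, ∀ s ∈ Set.Icc 0 G.T, ∀ t ∈ Set.Icc 0 G.T,
        G.gam β₀ ε n s + G.q β₀ ε n t ≤ c' * e ^ 2) :
    ∃ κ > 0, ∀ e > 0, e ≤ 1 / (c' + 1) → ∃ n₀ ≥ 1,
      ∀ (β₀ : ℝ → State m N → Ctrl m) (ε : ℕ → ℝ → State m N → Ctrl m),
        G.Admissible β₀ → (∀ n ≥ 1, G.Admissible (ε n)) → (∀ n ≥ 1, G.sNorm (ε n) ≤ e) →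
        ∀ n ≥ n₀, G.IsApproxMPE (κ * (c' + 1) * e) (G.picardErr β₀ ε n) := by
  obtain ⟨K, hK0, hK⟩ := exists_isApproxMPE_const G
  have hT := G.T_pos
  -- The value distance is at most `r = 2(c'+1)e + e`, and `e + 2r ≤ 7(c'+1)e`; the summand `1`
  -- gives positivity.
  refine ⟨7 * K + 1, by positivity, fun e he he1 => ?_⟩
  set B := (√(Fintype.card (State m N)) * (2 * G.level 0)) ^ 2 with hB
  have hlim := (FloorSemiring.tendsto_pow_div_factorial_atTop (c * c₀ ^ 2 * G.T)).const_mul B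
  rw [mul_zero] at hlim
  obtain ⟨n₁, hn₁⟩ := Filter.eventually_atTop.1 (hlim.eventually_le_const (pow_pos he 2))
  refine ⟨n₁ + 1, by omega, fun β₀ ε h₀ hε heps n hn => ?_⟩
  obtain ⟨k, rfl⟩ : ∃ k, n = k + 1 := ⟨n - 1, by omega⟩
  have hk : n₁ ≤ k := by omega
  -- The smallness of `e` is needed only here: the gap estimate admits perturbations of norm at most
  -- `1`.
  have he1' : e ≤ 1 := he1.trans (by rw [div_le_one (by positivity)]; linarith)
  have hq : ∀ n, ∀ t ∈ Set.Icc 0 G.T,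
      l2 (G.value (G.picardErr β₀ ε n) t - G.value (G.picard β₀ n) t) ≤ (c' + 1) * e := by
    intro n t ht
    have h1 := hc' β₀ ε e h₀ hε heps (n + 1) (by omega) t ht t ht
    have h2 : 0 ≤ G.gam β₀ ε (n + 1) t := sq_nonneg _
    have h3 : l2 (G.value (G.picardErr β₀ ε n) t - G.value (G.picard β₀ n) t) ^ 2 ≤
      c' * e ^ 2 := by
      have : G.q β₀ ε (n + 1) t =
        l2 (G.value (G.picardErr β₀ ε n) t - G.value (G.picard β₀ n) t) ^ 2 := rfl
      linarith
    refine le_of_sq_le_sq ?_ (by positivity)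
    refine h3.trans ?_
    rw [mul_pow]
    gcongr
    nlinarith
  have hD : ∀ t ∈ Set.Icc 0 G.T,
      l2 (G.value (G.picard β₀ (k + 1)) t - G.value (G.picard β₀ k) t) ≤ e := by
    intro t ht
    refine le_of_sq_le_sq ?_ he.le
    refine (picard_value_sub_le hc₀ hc h₀ k ht).trans (le_trans ?_ (hn₁ k hk))
    rw [← hB, mul_assoc, mul_pow (c * c₀ ^ 2) G.T, mul_div_assoc]
    have h1 := hc.1
    have h2 : 0 ≤ G.T - t := sub_nonneg.2 ht.2
    gcongr
    linarith [ht.1]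
  have hMPE := hK (G.picardErr β₀ ε k) (ε (k + 1)) e (2 * ((c' + 1) * e) + e)
    (admissible_picardErr h₀ hε k) (hε _ (by omega)) (heps _ (by omega)) he1' ?_
  · rw [show G.bestResponse (G.picardErr β₀ ε k) + ε (k + 1) = G.picardErr β₀ ε (k + 1) from rfl]
      at hMPE
    refine ⟨hMPE.1, fun t ht ξ α hα => (hMPE.2 t ht ξ α hα).trans ?_⟩
    have h1 : e + 2 * (2 * ((c' + 1) * e) + e) ≤ 7 * ((c' + 1) * e) := by nlinarith
    have h2 : K * (e + 2 * (2 * ((c' + 1) * e) + e)) ≤ K * (7 * ((c' + 1) * e)) := by gcongr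
    have h3 : 0 ≤ (c' + 1) * e := by positivity
    linarith
  · intro t ht
    have e1 : G.value (G.picardErr β₀ ε k) t
        - G.value (G.bestResponse (G.picardErr β₀ ε k) + ε (k + 1)) t =
      (G.value (G.picardErr β₀ ε k) t - G.value (G.picard β₀ k) t)
      + ((G.value (G.picard β₀ k) t - G.value (G.picard β₀ (k + 1)) t)
      + (G.value (G.picard β₀ (k + 1)) t - G.value (G.picardErr β₀ ε (k + 1)) t)) := by
      simp only [picardErr]; abel
    rw [e1]
    refine (l2_add_le _ _).trans ?_
    have h2 := l2_add_le (G.value (G.picard β₀ k) t - G.value (G.picard β₀ (k + 1)) t)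
      (G.value (G.picard β₀ (k + 1)) t - G.value (G.picardErr β₀ ε (k + 1)) t)
    rw [l2_sub_comm (G.value (G.picard β₀ k) t),
      l2_sub_comm _ (G.value (G.picardErr β₀ ε (k + 1)) t)] at h2
    linarith [hq k t ht, hq (k + 1) t ht, hD t ht]

end Game

end PicardGame

end

/-- In (c), `e` runs over all upper bounds of the errors, in place of a supremum that may be
infinite. The independent times `s` and `t` express the sum of two maxima. The threshold `n₀` is
chosen before `β₀` and `ε`. -/
theorem proposition5p5 (m N : ℕ) (hN : 0 < N) (G : PicardGame.Game m N) :
    (∃ c₀, G.IsResponseConst c₀) ∧ (∃ c, G.IsStabilityConst c) ∧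
    (∀ c₀ c, G.IsResponseConst c₀ → G.IsStabilityConst c →
      ∀ (β₀ : ℝ → PicardGame.State m N → PicardGame.Ctrl m)
        (ε : ℕ → ℝ → PicardGame.State m N → PicardGame.Ctrl m),
        G.Admissible β₀ → (∀ n ≥ 1, G.Admissible (ε n)) →
        ∀ n ≥ 2, ∀ t ∈ Set.Icc 0 G.T,
          G.gam β₀ ε (n - 1) t ≤ G.GammaBound c₀ c ε (n - 1) t ∧
          G.q β₀ ε n t ≤ G.QBound c₀ c ε n t) ∧
    (∃ κ > 0, ∃ c' > 0,
      (∀ (β₀ : ℝ → PicardGame.State m N → PicardGame.Ctrl m)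
        (ε : ℕ → ℝ → PicardGame.State m N → PicardGame.Ctrl m) (e : ℝ),
        G.Admissible β₀ → (∀ n ≥ 1, G.Admissible (ε n)) → (∀ n ≥ 1, G.sNorm (ε n) ≤ e) →
        ∀ n ≥ 1, ∀ s ∈ Set.Icc 0 G.T, ∀ t ∈ Set.Icc 0 G.T,
          G.gam β₀ ε n s + G.q β₀ ε n t ≤ c' * e ^ 2) ∧
      (∀ e > 0, e ≤ 1 / (c' + 1) → ∃ n₀ ≥ 1,
        ∀ (β₀ : ℝ → PicardGame.State m N → PicardGame.Ctrl m)
          (ε : ℕ → ℝ → PicardGame.State m N → PicardGame.Ctrl m),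
          G.Admissible β₀ → (∀ n ≥ 1, G.Admissible (ε n)) → (∀ n ≥ 1, G.sNorm (ε n) ≤ e) →
          ∀ n ≥ n₀, G.IsApproxMPE (κ * (c' + 1) * e) (G.picardErr β₀ ε n))) := by
  obtain ⟨c₀, hc₀⟩ := G.exists_isResponseConst
  obtain ⟨c, hc⟩ := G.exists_isStabilityConst
  refine ⟨⟨c₀, hc₀⟩, ⟨c, hc⟩, ?_, ?_⟩
  · intro c₀ c hc₀ hc β₀ ε h₀ hε n hn t ht
    obtain ⟨k, rfl⟩ : ∃ k, n = k + 1 := ⟨n - 1, by omega⟩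
    have h := PicardGame.Game.gam_le_and_q_succ_le hc₀ hc h₀ hε k
    exact ⟨h.1 t ht, h.2 t ht⟩
  · have hpos : 0 < 2 * (PicardGame.Game.chat c₀ *
        Real.exp (c * PicardGame.Game.chat c₀ * G.T)) := by
      have := PicardGame.Game.two_le_chat c₀
      positivity
    have hbound := fun β₀ ε e h₀ hε he n hn s hs t ht =>
      PicardGame.Game.gam_add_q_le (β₀ := β₀) (ε := ε) (e := e) (n := n) (s := s) (t := t)
        hc₀ hc h₀ hε he hn hs ht
    obtain ⟨κ, hκ, h⟩ := PicardGame.Game.exists_picardErr_isApproxMPE hc₀ hc hpos hbound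
    exact ⟨κ, hκ, _, hpos, hbound, h⟩
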